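/- Let $2<p<\infty$, $\frac1p+\frac1q=1$, and let $I\subset\mathbb{R}$ be a finite non-degenerate interval; $\langle h\rangle_I=|I|^{-1}\int_I h$. For $x\in\mathbb{R}^4$ put $$\mathbb{B}_{c,+}(x)=\sup\big\{\langle fg\rangle_I : f\in L^p(I),\ g\in L^q(I)\text{ real-valued},\ \langle f\rangle_I=x_1,\ \langle g\rangle_I=x_2,\ \langle |f|^p\rangle_I=x_3,\ \langle |g|^q\rangle_I=x_4\big\}$$ (with $\sup\emptyset=-\infty$), and let $\Omega_c=\{x\in\mathbb{R}^4: x_3\ge|x_1|^p,\ x_4\ge|x_2|^q\}$. Let $\varphi(R)=R|R|^{p-2}$, and let $\lambda(R)=\frac1{1+R}-\frac{p-1}{1+\varphi(R)}$ for $R\neq-1$, $\lambda(-1)=-\frac{p-2}2$. Let $R_0$ be the unique solution in $(0,1)$ of $$R_0^{\frac{p-1}2}+R_0^{-\frac{p-1}2}=(p-1)\big(R_0^{\frac12}+R_0^{-\frac12}\big).$$ Define $\rho:[-1,1]\to[R_0,1]$ as follows: for $R\in[-1,R_0]$, $\rho(R)$ is the unique point of $[R_0,1]$ with $\lambda(\rho(R))=\lambda(R)$;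 for $R\in[R_0,1]$, $\rho(R)=R$. For $R\in[-1,1]$ and $a_1,a_2\in\mathbb{R}$ let $\ell_c(a_1,a_2,R)$ be the segment with the endpoints $$a=(a_1,a_2,|a_1|^p,|a_2|^q),\qquad b=\big(-\rho(R)a_1,\,-\varphi(R)a_2,\,|\rho(R)a_1|^p,\,|R|^p|a_2|^q\big).$$ **Theorem.** 1. For all $R\in[-1,1]$ and $a_1,a_2\in\mathbb{R}$ with $a_1a_2>0$, the function $\mathbb{B}_{c,+}$ is linear on $\ell_c(a_1,a_2,R)$, that is, $\mathbb{B}_{c,+}(\tau a+(1-\tau)b)=\tau\,\mathbb{B}_{c,+}(a)+(1-\tau)\,\mathbb{B}_{c,+}(b)$ for $\tau\in[0,1]$, and its values are $$\mathbb{B}_{c,+}(\tau a+(1-\tau)b)=a_1a_2\big(\tau+(1-\tau)\rho(R)\varphi(R)\big),\qquad \tau\in[0,1].$$ 2. If $R\in[R_0,1]$ and $a_1a_2>0$, then $\mathbb{B}_{c,+}(x)=x_3^{1/p}x_4^{1/q}$ for every $x\in\ell_c(a_1,a_2,R)$. 3. The segments $\ell_c(a_1,a_2,R)$ with $a_1>0$,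 $a_2>0$, $R\in[-1,1]$ cover the set $$\Big\{x\in\Omega_c : x_3,x_4>0,\ -1<\frac{x_1}{x_3^{1/p}}\le\frac{x_2}{x_4^{1/q}}<1\Big\}.$$ 4. The segments $\ell_c(a_1,a_2,R)$ with $a_1<0$, $a_2<0$, $R\in[-1,1]$ cover the set $$\Big\{x\in\Omega_c : x_3,x_4>0,\ -1<\frac{x_2}{x_4^{1/q}}\le\frac{x_1}{x_3^{1/p}}<1\Big\}.$$ -/

import Mathlib

open MeasureTheory Set

noncomputable section

namespace SharpHoelder

/-! Points of `ℝ⁴` are functions `Fin 4 → ℝ`; the coordinates `x₁, x₂, x₃, x₄` are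
`x 0, x 1, x 2, x 3`. -/

/-- The Bellman function `B_{c,+}` for the exponents `p, q` and the interval `[α, β]`:
the supremum of the average of `f g` over all real-valued `f ∈ L^p`, `g ∈ L^q` on `[α, β]`
whose averages of `f`, `g`, `|f|^p`, `|g|^q` are `x₁, x₂, x₃, x₄`.
The supremum is taken in `[-∞, ∞]`, so that it is `-∞` when there are no such `f, g`. -/
def bellmanC (p q α β : ℝ) (x : Fin 4 → ℝ) : EReal :=
  ⨆ (f : ℝ → ℝ) (g : ℝ → ℝ)
    (_ : MemLp f (ENNReal.ofReal p) (volume.restrict (Icc α β)))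
    (_ : MemLp g (ENNReal.ofReal q) (volume.restrict (Icc α β)))
    (_ : ⨍ s in Icc α β, f s = x 0)
    (_ : ⨍ s in Icc α β, g s = x 1)
    (_ : ⨍ s in Icc α β, |f s| ^ p = x 2)
    (_ : ⨍ s in Icc α β, |g s| ^ q = x 3),
    ((⨍ s in Icc α β, f s * g s : ℝ) : EReal)

/-- The domain `Ω_c`. -/
def omegaC (p q : ℝ) : Set (Fin 4 → ℝ) :=
  {x | |x 0| ^ p ≤ x 2 ∧ |x 1| ^ q ≤ x 3}

/-- `φ(R) = R |R|^(p-2)`. -/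
def phi (p R : ℝ) : ℝ := R * |R| ^ (p - 2)

/-- `λ(R) = 1/(1+R) - (p-1)/(1+φ(R))` for `R ≠ -1`, and `λ(-1) = -(p-2)/2`. -/
def lam (p R : ℝ) : ℝ :=
  if R = -1 then -(p - 2) / 2 else 1 / (1 + R) - (p - 1) / (1 + phi p R)

/-- The equation that defines `R₀`. -/
def R0Equation (p R : ℝ) : Prop :=
  R ^ ((p - 1) / 2) + R ^ (-((p - 1) / 2)) = (p - 1) * (R ^ (1 / 2 : ℝ) + R ^ (-(1 / 2) : ℝ))

/-- The number `R₀`: the solution in `(0,1)` of `R0Equation`. For `p > 2` it exists and is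
unique, see `R0_mem`, `R0_equation` and `R0_unique`. -/
def R0 (p : ℝ) : ℝ := sInf {R | R ∈ Ioo (0 : ℝ) 1 ∧ R0Equation p R}

/-- The function `ρ : [-1,1] → [R₀,1]`: for `R ≤ R₀` the value `ρ(R)` is the point `s` of
`[R₀,1]` with `λ(s) = λ(R)` (for `p > 2` and `R ∈ [-1,R₀]` it exists and is unique, see
`rho_mem`, `lam_rho` and `rho_unique`), and `ρ(R) = R` for `R > R₀`. -/
def rho (p R : ℝ) : ℝ :=
  if R ≤ R0 p then sInf {s | s ∈ Icc (R0 p) 1 ∧ lam p s = lam p R} else R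

/-- The endpoint `a = (a₁, a₂, |a₁|^p, |a₂|^q)`. -/
def endpointA (p q a₁ a₂ : ℝ) : Fin 4 → ℝ := ![a₁, a₂, |a₁| ^ p, |a₂| ^ q]

/-- The endpoint `b = (-ρ(R) a₁, -φ(R) a₂, |ρ(R) a₁|^p, |R|^p |a₂|^q)`. -/
def endpointB (p q a₁ a₂ R : ℝ) : Fin 4 → ℝ :=
  ![-rho p R * a₁, -phi p R * a₂, |rho p R * a₁| ^ p, |R| ^ p * |a₂| ^ q]

/-- The segment `ℓ_c(a₁, a₂, R)`. -/
def ellC (p q a₁ a₂ R : ℝ) : Set (Fin 4 → ℝ) :=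
  segment ℝ (endpointA p q a₁ a₂) (endpointB p q a₁ a₂ R)

/-! ### Existence and uniqueness of `R₀` and of `ρ(R)` -/

/-- Auxiliary function whose zero in `(0,1)` is `R₀`. -/
def kap (p R : ℝ) : ℝ := (p - 1) * (R ^ (p / 2 - 1) + R ^ (p / 2)) - (1 + R ^ (p - 1))

theorem kap_strictMono {p : ℝ} (hp : 2 < p) : StrictMonoOn (kap p) (Icc 0 1) := by
  have hd : ∀ x ∈ Ioo (0 : ℝ) 1, HasDerivAt (kap p)
      ((p - 1) * ((p / 2 - 1) * x ^ (p / 2 - 1 - 1) + p / 2 * x ^ (p / 2 - 1))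
        - (p - 1) * x ^ (p - 1 - 1)) x := by
    intro x hx
    have h1 := Real.hasDerivAt_rpow_const (x := x) (p := p / 2 - 1) (Or.inl hx.1.ne')
    have h2 := Real.hasDerivAt_rpow_const (x := x) (p := p / 2) (Or.inl hx.1.ne')
    have h3 := Real.hasDerivAt_rpow_const (x := x) (p := p - 1) (Or.inl hx.1.ne')
    exact ((h1.add h2).const_mul (p - 1)).sub (h3.const_add 1)
  apply strictMonoOn_of_deriv_pos (convex_Icc 0 1)
  · unfold kap
    apply ContinuousOn.sub
    · apply ContinuousOn.mul continuousOn_const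
      apply ContinuousOn.add
      · exact (Real.continuous_rpow_const (by linarith)).continuousOn
      · exact (Real.continuous_rpow_const (by linarith)).continuousOn
    · exact (continuous_const.add (Real.continuous_rpow_const (by linarith))).continuousOn
  · intro x hx
    rw [interior_Icc] at hx
    rw [(hd x hx).deriv]
    have h1 : x ^ (p - 1 - 1) ≤ x ^ (p / 2 - 1) :=
      Real.rpow_le_rpow_of_exponent_ge hx.1 hx.2.le (by linarith)
    have h2 : 0 < x ^ (p / 2 - 1) := Real.rpow_pos_of_pos hx.1 _
    have h3 : 0 < x ^ (p / 2 - 1 - 1) := Real.rpow_pos_of_pos hx.1 _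
    have h4 : 0 < (p / 2 - 1) * x ^ (p / 2 - 1 - 1) := mul_pos (by linarith) h3
    have h5 : 0 < (p / 2 - 1) * x ^ (p / 2 - 1) := mul_pos (by linarith) h2
    rw [← mul_sub]
    apply mul_pos (by linarith)
    linarith

theorem R0Equation_iff {p R : ℝ} (hR : 0 < R) : R0Equation p R ↔ kap p R = 0 := by
  have hpos : 0 < R ^ ((p - 1) / 2) := Real.rpow_pos_of_pos hR _
  have e1 : R ^ ((p - 1) / 2) * R ^ ((p - 1) / 2) = R ^ (p - 1) := by
    rw [← Real.rpow_add hR]; congr 1; ring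
  have e2 : R ^ ((p - 1) / 2) * R ^ (-((p - 1) / 2)) = 1 := by
    rw [← Real.rpow_add hR]; simp
  have e3 : R ^ ((p - 1) / 2) * R ^ (1 / 2 : ℝ) = R ^ (p / 2) := by
    rw [← Real.rpow_add hR]; congr 1; ring
  have e4 : R ^ ((p - 1) / 2) * R ^ (-(1 / 2) : ℝ) = R ^ (p / 2 - 1) := by
    rw [← Real.rpow_add hR]; congr 1; ring
  unfold R0Equation kap
  rw [← mul_right_inj' hpos.ne', mul_add, e1, e2, mul_left_comm, mul_add (R ^ ((p - 1) / 2)),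
    e3, e4]
  constructor <;> intro h <;> linarith

theorem exists_unique_R0 {p : ℝ} (hp : 2 < p) : ∃! R, R ∈ Ioo (0 : ℝ) 1 ∧ R0Equation p R := by
  have hm := kap_strictMono hp
  have hc : ContinuousOn (kap p) (Icc 0 1) := by
    unfold kap
    apply ContinuousOn.sub
    · apply ContinuousOn.mul continuousOn_const
      apply ContinuousOn.add
      · exact (Real.continuous_rpow_const (by linarith)).continuousOn
      · exact (Real.continuous_rpow_const (by linarith)).continuousOn
    · exact (continuous_const.add (Real.continuous_rpow_const (by linarith))).continuousOn
  have h0 : kap p 0 < 0 := by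
    unfold kap
    rw [Real.zero_rpow (by linarith), Real.zero_rpow (by linarith), Real.zero_rpow (by linarith)]
    norm_num
  have h1 : 0 < kap p 1 := by
    unfold kap
    simp only [Real.one_rpow]
    linarith
  obtain ⟨R, hR, hR'⟩ := intermediate_value_Ioo zero_le_one hc ⟨h0, h1⟩
  refine ⟨R, ⟨hR, (R0Equation_iff hR.1).2 hR'⟩, ?_⟩
  rintro S ⟨hS, hS'⟩
  exact hm.injOn ⟨hS.1.le, hS.2.le⟩ ⟨hR.1.le, hR.2.le⟩
    (((R0Equation_iff hS.1).1 hS').trans hR'.symm)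

theorem R0_spec {p : ℝ} (hp : 2 < p) : R0 p ∈ Ioo (0 : ℝ) 1 ∧ R0Equation p (R0 p) := by
  obtain ⟨R, hR, hu⟩ := exists_unique_R0 hp
  have : {R | R ∈ Ioo (0 : ℝ) 1 ∧ R0Equation p R} = {R} := by
    ext S
    exact ⟨fun h => hu S h, fun h => by rw [mem_singleton_iff.1 h]; exact hR⟩
  have h2 : R0 p = R := by rw [R0, this, csInf_singleton]
  rw [h2]; exact hR

theorem R0_mem {p : ℝ} (hp : 2 < p) : R0 p ∈ Ioo (0 : ℝ) 1 := (R0_spec hp).1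

theorem R0_equation {p : ℝ} (hp : 2 < p) : R0Equation p (R0 p) := (R0_spec hp).2

theorem R0_unique {p R : ℝ} (hp : 2 < p) (hR : R ∈ Ioo (0 : ℝ) 1) (h : R0Equation p R) :
    R = R0 p :=
  (exists_unique_R0 hp).unique ⟨hR, h⟩ (R0_spec hp)

theorem phi_of_nonneg {p R : ℝ} (hp : 2 < p) (hR : 0 ≤ R) : phi p R = R ^ (p - 1) := by
  unfold phi
  rw [abs_of_nonneg hR]
  rcases hR.eq_or_lt with rfl | h
  · rw [zero_mul, Real.zero_rpow (by linarith)]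
  · nth_rewrite 1 [← Real.rpow_one R]
    rw [← Real.rpow_add h]; congr 1; ring

theorem lam_of_nonneg {p R : ℝ} (hp : 2 < p) (hR : 0 ≤ R) :
    lam p R = 1 / (1 + R) - (p - 1) / (1 + R ^ (p - 1)) := by
  unfold lam
  rw [if_neg (by linarith), phi_of_nonneg hp hR]

theorem lam_hasDerivAt {p R : ℝ} (hp : 2 < p) (hR : 0 < R) :
    HasDerivAt (lam p) (((p - 1) * R ^ (p / 2 - 1) / (1 + R ^ (p - 1))) ^ 2 - (1 / (1 + R)) ^ 2)
      R := by
  have hpos : 0 < 1 + R ^ (p - 1) := by have := Real.rpow_pos_of_pos hR (p - 1); linarith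
  have h3 := Real.hasDerivAt_rpow_const (x := R) (p := p - 1) (Or.inl hR.ne')
  have h4 := ((h3.const_add 1).fun_inv hpos.ne').const_mul (p - 1)
  have h5 := ((hasDerivAt_id R).const_add 1).fun_inv (by simp; linarith)
  have h6 := h5.sub h4
  have e1 : R ^ (p - 1 - 1) = (R ^ (p / 2 - 1)) ^ 2 := by
    rw [sq, ← Real.rpow_add hR]; congr 1; ring
  have h7 := h6.congr_of_eventuallyEq (f₁ := lam p) (by
    filter_upwards [lt_mem_nhds hR] with x hx
    rw [lam_of_nonneg hp hx.le]
    simp [div_eq_mul_inv])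
  refine h7.congr_deriv ?_
  rw [e1]
  simp only [id]
  field_simp
  ring

theorem lam_continuousOn {p : ℝ} (hp : 2 < p) : ContinuousOn (lam p) (Icc 0 1) := by
  have : ContinuousOn (fun R : ℝ => 1 / (1 + R) - (p - 1) / (1 + R ^ (p - 1))) (Icc 0 1) := by
    apply ContinuousOn.sub
    · apply ContinuousOn.div continuousOn_const (by fun_prop)
      intro x hx
      linarith [hx.1]
    · apply ContinuousOn.div continuousOn_const
      · exact (continuous_const.add (Real.continuous_rpow_const (by linarith))).continuousOn
      · intro x hx
        have := Real.rpow_nonneg hx.1 (p - 1)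
        linarith
  exact this.congr fun x hx => lam_of_nonneg hp hx.1

theorem kap_factor {p R : ℝ} (hR : 0 < R) :
    kap p R = (p - 1) * R ^ (p / 2 - 1) * (1 + R) - (1 + R ^ (p - 1)) := by
  have : R ^ (p / 2) = R ^ (p / 2 - 1) * R := by
    nth_rewrite 3 [← Real.rpow_one R]
    rw [← Real.rpow_add hR]; congr 1; ring
  unfold kap
  rw [this]; ring

theorem lam_strictMonoOn {p : ℝ} (hp : 2 < p) : StrictMonoOn (lam p) (Icc (R0 p) 1) := by
  have hR0 := R0_mem hp
  have hk0 := (R0Equation_iff hR0.1).1 (R0_equation hp)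
  apply strictMonoOn_of_deriv_pos (convex_Icc _ _)
  · exact (lam_continuousOn hp).mono (Icc_subset_Icc_left hR0.1.le)
  · intro x hx
    rw [interior_Icc] at hx
    have hx0 : 0 < x := hR0.1.trans hx.1
    rw [(lam_hasDerivAt hp hx0).deriv]
    have hk := kap_strictMono hp ⟨hR0.1.le, hR0.2.le⟩ ⟨hx0.le, hx.2.le⟩ hx.1
    rw [hk0, kap_factor hx0] at hk
    have hpos : 0 < 1 + x ^ (p - 1) := by have := Real.rpow_pos_of_pos hx0 (p - 1); linarith
    rw [sub_pos]
    apply pow_lt_pow_left₀ _ (by positivity) two_ne_zero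
    rw [div_lt_div_iff₀ (by linarith) hpos]
    linarith

theorem lam_strictAntiOn {p : ℝ} (hp : 2 < p) : StrictAntiOn (lam p) (Icc 0 (R0 p)) := by
  have hR0 := R0_mem hp
  have hk0 := (R0Equation_iff hR0.1).1 (R0_equation hp)
  apply strictAntiOn_of_deriv_neg (convex_Icc _ _)
  · exact (lam_continuousOn hp).mono (Icc_subset_Icc_right hR0.2.le)
  · intro x hx
    rw [interior_Icc] at hx
    have hx0 : 0 < x := hx.1
    rw [(lam_hasDerivAt hp hx0).deriv]
    have hk := kap_strictMono hp ⟨hx0.le, (hx.2.trans hR0.2).le⟩ ⟨hR0.1.le, hR0.2.le⟩ hx.2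
    rw [hk0, kap_factor hx0] at hk
    have hpos : 0 < 1 + x ^ (p - 1) := by have := Real.rpow_pos_of_pos hx0 (p - 1); linarith
    have hpos2 := Real.rpow_pos_of_pos hx0 (p / 2 - 1)
    rw [sub_neg]
    apply pow_lt_pow_left₀ _ (by have : 0 < p - 1 := by linarith
                                 positivity) two_ne_zero
    rw [div_lt_div_iff₀ hpos (by linarith)]
    linarith

theorem amgm_aux {p s : ℝ} (hp : 2 < p) (hs : 0 < s) :
    (p - 1) * s ^ (p - 2) ≤ 1 + (p - 2) * s ^ (p - 1) := by
  have hn : 0 < p - 1 := by linarith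
  have h := Real.geom_mean_le_arith_mean2_weighted (w₁ := 1 / (p - 1)) (w₂ := (p - 2) / (p - 1))
    (p₁ := 1) (p₂ := s ^ (p - 1)) (by positivity) (div_nonneg (by linarith) hn.le) zero_le_one
    (Real.rpow_nonneg hs.le _) (by field_simp; ring)
  rw [Real.one_rpow, one_mul, ← Real.rpow_mul hs.le, mul_div_cancel₀ _ hn.ne'] at h
  have h2 := mul_le_mul_of_nonneg_left h hn.le
  calc _ ≤ _ := h2
    _ = _ := by field_simp

theorem coth_aux {p s : ℝ} (hp : 2 < p) (hs : s ∈ Ioo (0 : ℝ) 1) :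
    (1 + s) * (1 - s ^ (p - 1)) ≤ (p - 1) * (1 + s ^ (p - 1)) * (1 - s) := by
  let G : ℝ → ℝ := fun x => (p - 1) * (1 + x ^ (p - 1)) * (1 - x) - (1 + x) * (1 - x ^ (p - 1))
  have hr : Continuous fun x : ℝ => x ^ (p - 1) := Real.continuous_rpow_const (by linarith)
  have hG : AntitoneOn G (Icc s 1) := by
    apply antitoneOn_of_hasDerivWithinAt_nonpos (convex_Icc _ _)
      (f' := fun x => p * ((p - 1) * x ^ (p - 2) - 1 - (p - 2) * x ^ (p - 1)))
    · exact Continuous.continuousOn (by fun_prop)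
    · intro x hx
      rw [interior_Icc] at hx
      have hx0 : 0 < x := hs.1.trans hx.1
      have h3 := Real.hasDerivAt_rpow_const (x := x) (p := p - 1) (Or.inl hx0.ne')
      have h4 := ((h3.const_add 1).const_mul (p - 1)).mul ((hasDerivAt_id x).const_sub 1)
      have h5 := ((hasDerivAt_id x).const_add 1).mul (h3.const_sub 1)
      have h6 := (h4.sub h5).hasDerivWithinAt (s := interior (Icc s 1))
      refine h6.congr_deriv ?_
      have e : x ^ (p - 1) = x ^ (p - 2) * x := by
        nth_rewrite 3 [← Real.rpow_one x]
        rw [← Real.rpow_add hx0]; congr 1; ring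
      have e2 : p - 1 - 1 = p - 2 := by ring
      rw [e2, e]
      simp only [id]
      ring
    · intro x hx
      rw [interior_Icc] at hx
      have := amgm_aux hp (hs.1.trans hx.1)
      exact mul_nonpos_of_nonneg_of_nonpos (by linarith) (by linarith)
  have h := hG ⟨le_rfl, hs.2.le⟩ ⟨hs.2.le, le_rfl⟩ hs.2.le
  simp only [G, Real.one_rpow, sub_self, mul_zero] at h
  linarith

theorem lam_one {p : ℝ} (hp : 2 < p) : lam p 1 = -(p - 2) / 2 := by
  rw [lam_of_nonneg hp zero_le_one, Real.one_rpow]; ring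

theorem lam_bounds {p R : ℝ} (hp : 2 < p) (hR : R ∈ Icc (-1) (R0 p)) :
    lam p R ∈ Icc (lam p (R0 p)) (lam p 1) := by
  have hR0 := R0_mem hp
  have hlow : lam p (R0 p) ≤ lam p 0 :=
    (lam_strictAntiOn hp).antitoneOn ⟨le_rfl, hR0.1.le⟩ ⟨hR0.1.le, le_rfl⟩ hR0.1.le
  have hl0 : lam p 0 = 2 - p := by
    rw [lam_of_nonneg hp le_rfl, Real.zero_rpow (by linarith)]; ring
  have hl1 := lam_one hp
  rcases le_or_gt 0 R with h0 | h0
  · have h1 : lam p R ≤ lam p 0 :=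
      (lam_strictAntiOn hp).antitoneOn ⟨le_rfl, hR0.1.le⟩ ⟨h0, hR.2⟩ h0
    have h2 : lam p (R0 p) ≤ lam p R :=
      (lam_strictAntiOn hp).antitoneOn ⟨h0, hR.2⟩ ⟨hR0.1.le, le_rfl⟩ hR.2
    exact ⟨h2, by linarith⟩
  rcases hR.1.eq_or_lt with rfl | h1
  · have : lam p (-1) = lam p 1 := by rw [hl1]; simp [lam]
    rw [this]
    exact ⟨by linarith, le_rfl⟩
  · obtain ⟨s, rfl⟩ : ∃ s, R = -s := ⟨-R, by ring⟩
    have hs : s ∈ Ioo (0 : ℝ) 1 := ⟨by linarith, by linarith⟩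
    have e : s ^ (p - 1) = s ^ (p - 2) * s := by
      nth_rewrite 3 [← Real.rpow_one s]
      rw [← Real.rpow_add hs.1]; congr 1; ring
    have hl : lam p (-s) = 1 / (1 - s) - (p - 1) / (1 - s ^ (p - 1)) := by
      unfold lam phi
      rw [if_neg (by intro h; linarith), abs_neg, abs_of_pos hs.1, e]
      congr 2
      ring
    have hlt : s ^ (p - 1) < 1 := Real.rpow_lt_one hs.1.le hs.2 (by linarith)
    have ha := amgm_aux hp hs.1
    have hc := coth_aux hp hs
    have hs1 : 0 < 1 - s := by linarith [hs.2]
    have hs2 : 0 < 1 - s ^ (p - 1) := by linarith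
    have key : ∀ c : ℝ, 1 / (1 - s) - (p - 1) / (1 - s ^ (p - 1)) - c
        = ((1 - s ^ (p - 1)) - (p - 1) * (1 - s) - c * ((1 - s) * (1 - s ^ (p - 1))))
          / ((1 - s) * (1 - s ^ (p - 1))) := by
      intro c; field_simp
    have hpos : 0 < (1 - s) * (1 - s ^ (p - 1)) := mul_pos hs1 hs2
    constructor
    · refine hlow.trans ?_
      rw [hl0, hl, ← sub_nonneg, key]
      apply div_nonneg _ hpos.le
      have := mul_le_mul_of_nonneg_left ha hs.1.le
      rw [show s * ((p - 1) * s ^ (p - 2)) = (p - 1) * s ^ (p - 1) by rw [e]; ring] at this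
      nlinarith
    · rw [hl1, hl, ← sub_nonpos, key]
      apply div_nonpos_of_nonpos_of_nonneg _ hpos.le
      nlinarith

theorem exists_unique_rho {p R : ℝ} (hp : 2 < p) (hR : R ∈ Icc (-1) (R0 p)) :
    ∃! s, s ∈ Icc (R0 p) 1 ∧ lam p s = lam p R := by
  have hR0 := R0_mem hp
  obtain ⟨s, hs, hs'⟩ := intermediate_value_Icc hR0.2.le
    ((lam_continuousOn hp).mono (Icc_subset_Icc_left hR0.1.le)) (lam_bounds hp hR)
  refine ⟨s, ⟨hs, hs'⟩, ?_⟩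
  rintro t ⟨ht, ht'⟩
  exact (lam_strictMonoOn hp).injOn ht hs (ht'.trans hs'.symm)

theorem rho_spec {p R : ℝ} (hp : 2 < p) (hR : R ∈ Icc (-1) (R0 p)) :
    rho p R ∈ Icc (R0 p) 1 ∧ lam p (rho p R) = lam p R := by
  obtain ⟨s, hs, hu⟩ := exists_unique_rho hp hR
  have : {s | s ∈ Icc (R0 p) 1 ∧ lam p s = lam p R} = {s} := by
    ext t
    exact ⟨fun h => hu t h, fun h => by rw [mem_singleton_iff.1 h]; exact hs⟩
  have h2 : rho p R = s := by rw [rho, if_pos hR.2, this, csInf_singleton]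
  rw [h2]; exact hs

theorem lam_rho {p R : ℝ} (hp : 2 < p) (hR : R ∈ Icc (-1) (R0 p)) :
    lam p (rho p R) = lam p R := (rho_spec hp hR).2

theorem rho_unique {p R s : ℝ} (hp : 2 < p) (hR : R ∈ Icc (-1) (R0 p))
    (hs : s ∈ Icc (R0 p) 1) (h : lam p s = lam p R) : s = rho p R :=
  (exists_unique_rho hp hR).unique ⟨hs, h⟩ (rho_spec hp hR)

theorem rho_of_ge {p R : ℝ} (hp : 2 < p) (hR : R0 p ≤ R) : rho p R = R := by
  rcases hR.eq_or_lt with rfl | h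
  · have hR0 := R0_mem hp
    exact (rho_unique hp ⟨by linarith [hR0.1], le_rfl⟩ ⟨le_rfl, hR0.2.le⟩ rfl).symm
  · rw [rho, if_neg (not_le.2 h)]

theorem rho_mem {p R : ℝ} (hp : 2 < p) (hR : R ∈ Icc (-1 : ℝ) 1) : rho p R ∈ Icc (R0 p) 1 := by
  rcases le_total R (R0 p) with h | h
  · exact (rho_spec hp ⟨hR.1, h⟩).1
  · rw [rho_of_ge hp h]; exact ⟨h, hR.2⟩

end SharpHoelder

end

namespace SharpHoelder

/-! ### Bounds for the Bellman function -/

/-! Lower bound on a segment: let `(f, g)` take the value `(a₁, a₂)` on a portion `τ` of the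
interval and `(-ρ(R)a₁, -φ(R)a₂)` on the rest. Since `|φ(R)|^q = |R|^p`, this pair is admissible at
the given point and yields the claimed value (`le_bellmanC`).

Upper bound: after scaling to `a₁ = a₂ = 1`, it suffices to dominate `uv` by a combination of `1, u,
v, |u|^p, |v|^q` with equality at `(1, 1)` and `(-ρ(R), -φ(R))`, and to average
(`bellmanC_le_of_majorant`). Young's inequality applied to `w = 1 + (u - 1)/k` and `v` eliminates
`v` and leaves a one-variable inequality `G(u) ≥ 0`. The parameters make `G'` vanish at `1` and
`-ρ(R)`, and `G(1) = 0`; the remaining condition `G(-ρ(R)) = 0` is exactly `λ(ρ(R)) = λ(R)`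
(`touching_identity`). As `G'` increases, decreases and increases again, these conditions force `G ≥
0` (`exists_majorant`). For `R ≥ R₀`, `G` is identically zero, and Hölder's inequality is attained.
At `R = -1` the construction degenerates, but there `g` must be constant.

Covering: by homogeneity only `x₁/x₃^(1/p)` and `x₂/x₄^(1/q)` matter. For each `R` exactly one `τ`
gives the first ratio; the second is then continuous in `R`, and the intermediate value theorem
applies (`exists_ratios_eq`). -/

theorem setAverage_step {α β τ : ℝ} (hαβ : α < β) (hτ : τ ∈ Icc (0 : ℝ) 1) (u w : ℝ) :
    ⨍ s in Icc α β, (if s ≤ α + τ * (β - α) then u else w) = τ * u + (1 - τ) * w := by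
  have hd : 0 < β - α := sub_pos.2 hαβ
  have h1 : α ≤ α + τ * (β - α) := by nlinarith [hτ.1]
  have h2 : α + τ * (β - α) ≤ β := by nlinarith [hτ.2]
  have hi1 : IntegrableOn (fun s => if s ≤ α + τ * (β - α) then u else w)
      (Icc α (α + τ * (β - α))) :=
    (integrableOn_const (C := u) (by simp) (by simp)).congr_fun
      (fun s hs => (if_pos hs.2).symm) measurableSet_Icc
  have hi2 : IntegrableOn (fun s => if s ≤ α + τ * (β - α) then u else w)
      (Ioc (α + τ * (β - α)) β) :=
    (integrableOn_const (C := w) (by simp) (by simp)).congr_fun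
      (fun s hs => (if_neg (not_le.2 hs.1)).symm) measurableSet_Ioc
  have e1 : ∫ s in Icc α (α + τ * (β - α)), (if s ≤ α + τ * (β - α) then u else w)
      = τ * (β - α) * u := by
    rw [setIntegral_congr_fun (g := fun _ => u) measurableSet_Icc (fun s hs => if_pos hs.2)]
    simp [max_eq_left (mul_nonneg hτ.1 hd.le)]
  have e2 : ∫ s in Ioc (α + τ * (β - α)) β, (if s ≤ α + τ * (β - α) then u else w)
      = (β - (α + τ * (β - α))) * w := by
    rw [setIntegral_congr_fun (g := fun _ => w) measurableSet_Ioc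
      (fun s hs => if_neg (not_le.2 hs.1))]
    simp [h2]
  have hdisj : Disjoint (Icc α (α + τ * (β - α))) (Ioc (α + τ * (β - α)) β) :=
    Set.disjoint_left.2 fun s hs hs' => absurd hs.2 (not_le.2 hs'.1)
  rw [setAverage_eq, ← Icc_union_Ioc_eq_Icc h1 h2,
    setIntegral_union hdisj measurableSet_Ioc hi1 hi2, e1, e2, Icc_union_Ioc_eq_Icc h1 h2]
  simp only [measureReal_def, Real.volume_Icc, smul_eq_mul, ENNReal.toReal_ofReal hd.le]
  field_simp
  ring

theorem memLp_step (r : ENNReal) (α β c u w : ℝ) :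
    MemLp (fun s : ℝ => if s ≤ c then u else w) r (volume.restrict (Icc α β)) := by
  refine MemLp.of_bound (Measurable.ite measurableSet_Iic measurable_const
    measurable_const).aestronglyMeasurable (max |u| |w|) (ae_of_all _ fun s => ?_)
  split_ifs
  · exact le_max_left _ _
  · exact le_max_right _ _

/-- The competitors are two-valued functions that jump at the same point, which divides the interval
in the ratio `τ : 1 - τ`. -/
theorem le_bellmanC {p q α β τ : ℝ} (hαβ : α < β) (hτ : τ ∈ Icc (0 : ℝ) 1) {x : Fin 4 → ℝ}
    (u v u' v' : ℝ) (h0 : x 0 = τ * u + (1 - τ) * u') (h1 : x 1 = τ * v + (1 - τ) * v')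
    (h2 : x 2 = τ * |u| ^ p + (1 - τ) * |u'| ^ p) (h3 : x 3 = τ * |v| ^ q + (1 - τ) * |v'| ^ q) :
    ((τ * (u * v) + (1 - τ) * (u' * v') : ℝ) : EReal) ≤ bellmanC p q α β x := by
  unfold bellmanC
  refine le_iSup_of_le (fun s => if s ≤ α + τ * (β - α) then u else u') <|
    le_iSup_of_le (fun s => if s ≤ α + τ * (β - α) then v else v') <|
    le_iSup_of_le (memLp_step _ _ _ _ _ _) <| le_iSup_of_le (memLp_step _ _ _ _ _ _) <|
    le_iSup_of_le ?_ <| le_iSup_of_le ?_ <| le_iSup_of_le ?_ <| le_iSup_of_le ?_ ?_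
  · rw [h0, setAverage_step hαβ hτ]
  · rw [h1, setAverage_step hαβ hτ]
  · simp only [apply_ite abs, apply_ite (fun t : ℝ => t ^ p)]
    rw [h2, setAverage_step hαβ hτ]
  · simp only [apply_ite abs, apply_ite (fun t : ℝ => t ^ q)]
    rw [h3, setAverage_step hαβ hτ]
  · rw [← setAverage_step hαβ hτ]
    apply le_of_eq
    congr 2
    ext s
    dsimp only
    split_ifs <;> rfl

theorem integrable_abs_rpow {r : ℝ} (hr : 0 < r) {μ : Measure ℝ} {f : ℝ → ℝ}
    (hf : MemLp f (ENNReal.ofReal r) μ) : Integrable (fun s => |f s| ^ r) μ := by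
  simpa [ENNReal.toReal_ofReal hr.le] using
    hf.integrable_norm_rpow (by simpa using hr) ENNReal.ofReal_ne_top

/-- Averaging the pointwise inequality at `u = f s`, `v = g s` turns its right side into an affine
function of the four prescribed averages. -/
theorem bellmanC_le_of_majorant {p q α β : ℝ} (hpq : p.HolderConjugate q) (hαβ : α < β)
    {c₀ c₁ c₂ c₃ c₄ : ℝ}
    (h : ∀ u v : ℝ, u * v ≤ c₀ + c₁ * u + c₂ * v + c₃ * |u| ^ p + c₄ * |v| ^ q)
    (x : Fin 4 → ℝ) :
    bellmanC p q α β x ≤ ((c₀ + c₁ * x 0 + c₂ * x 1 + c₃ * x 2 + c₄ * x 3 : ℝ) : EReal) := by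
  unfold bellmanC
  refine iSup_le fun f => iSup_le fun g => iSup_le fun hf => iSup_le fun hg => iSup_le fun h0 =>
    iSup_le fun h1 => iSup_le fun h2 => iSup_le fun h3 => EReal.coe_le_coe_iff.2 ?_
  have hd : 0 < β - α := sub_pos.2 hαβ
  have hif : Integrable f (volume.restrict (Icc α β)) :=
    hf.integrable (by simpa using hpq.lt.le)
  have hig : Integrable g (volume.restrict (Icc α β)) :=
    hg.integrable (by simpa using hpq.symm.lt.le)
  have hfp := integrable_abs_rpow hpq.pos hf
  have hgq := integrable_abs_rpow hpq.symm.pos hg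
  have hfg : Integrable (fun s => f s * g s) (volume.restrict (Icc α β)) := by
    -- Needed in the context as an instance for `MemLp.integrable_mul`.
    have := hpq.ennrealOfReal
    exact hf.integrable_mul hg
  have hc : Integrable (fun _ : ℝ => c₀) (volume.restrict (Icc α β)) := integrable_const _
  have ha : Integrable (fun s => c₀ + c₁ * f s) (volume.restrict (Icc α β)) :=
    hc.add (hif.const_mul c₁)
  have hb : Integrable (fun s => c₀ + c₁ * f s + c₂ * g s) (volume.restrict (Icc α β)) :=
    ha.add (hig.const_mul c₂)
  have he : Integrable (fun s => c₀ + c₁ * f s + c₂ * g s + c₃ * |f s| ^ p)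
      (volume.restrict (Icc α β)) := hb.add (hfp.const_mul c₃)
  have hle := integral_mono hfg (he.add (hgq.const_mul c₄)) (fun s => h (f s) (g s))
  simp only [Pi.add_apply] at hle
  simp only [setAverage_eq, smul_eq_mul] at h0 h1 h2 h3 ⊢
  rw [integral_add he (hgq.const_mul c₄), integral_add hb (hfp.const_mul c₃),
    integral_add ha (hig.const_mul c₂), integral_add hc (hif.const_mul c₁),
    integral_const_mul, integral_const_mul, integral_const_mul, integral_const_mul,
    integral_const] at hle
  rw [← h0, ← h1, ← h2, ← h3]
  have hv : volume.real (Icc α β) = β - α := by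
    simp [measureReal_def, ENNReal.toReal_ofReal hd.le]
  simp only [measureReal_restrict_apply_univ, hv, smul_eq_mul] at hle ⊢
  have := mul_le_mul_of_nonneg_left hle (inv_nonneg.2 hd.le)
  refine this.trans_eq ?_
  field_simp

/-- Strict convexity at the tangency point `1`: Bernoulli's inequality for `w ≥ 0`, while for `w <
0` the tangent is already negative. -/
theorem one_add_mul_sub_lt_abs_rpow {q w : ℝ} (hq : 1 < q) (hw : w ≠ 1) :
    1 + q * (w - 1) < |w| ^ q := by
  rcases le_or_gt 0 w with h | h
  · have := one_add_mul_self_lt_rpow_one_add (s := w - 1) (by linarith) (sub_ne_zero.2 hw) hq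
    rw [add_sub_cancel] at this
    rwa [abs_of_nonneg h]
  · have := Real.rpow_nonneg (abs_nonneg w) q
    nlinarith

/-- If `⟨|g|^q⟩ = |⟨g⟩|^q`, then `g` is constant. -/
theorem bellmanC_le_of_boundary {p q α β : ℝ} (hpq : p.HolderConjugate q) (hαβ : α < β)
    {x : Fin 4 → ℝ} (hx1 : x 1 ≠ 0) (hx3 : x 3 = |x 1| ^ q) :
    bellmanC p q α β x ≤ ((x 0 * x 1 : ℝ) : EReal) := by
  unfold bellmanC
  refine iSup_le fun f => iSup_le fun g => iSup_le fun hf => iSup_le fun hg => iSup_le fun h0 =>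
    iSup_le fun h1 => iSup_le fun h2 => iSup_le fun h3 => EReal.coe_le_coe_iff.2 (le_of_eq ?_)
  have hd : 0 < β - α := sub_pos.2 hαβ
  have hig : Integrable g (volume.restrict (Icc α β)) :=
    hg.integrable (by simpa using hpq.symm.lt.le)
  have hgq := integrable_abs_rpow hpq.symm.pos hg
  have hpos : 0 < |x 1| ^ q := Real.rpow_pos_of_pos (abs_pos.2 hx1) q
  set c := |x 1| ^ q with hcdef
  -- The gap between `|v|^q` and its tangent line at `x 1`. It has zero average by `hx3`, so it
  -- vanishes almost everywhere, and strictness gives `g = x 1` almost everywhere.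
  have hgap : ∀ v : ℝ, v ≠ x 1 → 0 < |v| ^ q - (c + q * c * (v / x 1 - 1)) := by
    intro v hv
    have hlt := one_add_mul_sub_lt_abs_rpow (w := v / x 1) hpq.symm.lt
      (fun h => hv ((div_eq_one_iff_eq hx1).1 h))
    rw [abs_div, Real.div_rpow (abs_nonneg _) (abs_nonneg _), lt_div_iff₀ hpos] at hlt
    linarith
  have hint : ∫ s in Icc α β, (|g s| ^ q - (c + q * c * (g s / x 1 - 1))) = 0 := by
    have hi3 : Integrable (fun s => g s / x 1 - 1) (volume.restrict (Icc α β)) :=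
      (hig.div_const _).sub (integrable_const _)
    have hi4 : Integrable (fun s => c + q * c * (g s / x 1 - 1)) (volume.restrict (Icc α β)) :=
      (integrable_const _).add (hi3.const_mul _)
    rw [integral_sub hgq hi4, integral_add (integrable_const _) (hi3.const_mul _), integral_const_mul,
      integral_sub (hig.div_const _) (integrable_const _), integral_div, integral_const,
      integral_const]
    simp only [setAverage_eq, smul_eq_mul] at h1 h3
    have hv : volume.real (Icc α β) = β - α := by
      simp [measureReal_def, ENNReal.toReal_ofReal hd.le]
    rw [hv, inv_mul_eq_iff_eq_mul₀ hd.ne'] at h1 h3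
    simp only [measureReal_restrict_apply_univ, hv, smul_eq_mul]
    rw [h1, h3, hx3]
    field_simp
    ring
  have hi : Integrable (fun s => |g s| ^ q - (c + q * c * (g s / x 1 - 1)))
      (volume.restrict (Icc α β)) :=
    hgq.sub ((integrable_const _).add
      (((hig.div_const _).sub (integrable_const _)).const_mul _))
  have hnn : 0 ≤ fun s => |g s| ^ q - (c + q * c * (g s / x 1 - 1)) := by
    intro s
    by_cases hs : g s = x 1
    · simp [hs, div_self hx1, hcdef]
    · exact (hgap _ hs).le
  have hae := (integral_eq_zero_iff_of_nonneg hnn hi).1 hint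
  have hg' : ∀ᵐ s ∂(volume.restrict (Icc α β)), f s * g s = f s * x 1 := by
    filter_upwards [hae] with s hs
    by_contra hne
    exact (hgap (g s) (fun h => hne (by rw [h]))).ne' hs
  rw [average_congr hg', setAverage_eq, integral_mul_const, ← h0, setAverage_eq, smul_eq_mul,
    smul_eq_mul, mul_assoc]

/-! ### The affine majorant touching at the two endpoints -/

theorem continuous_phi {p : ℝ} (hp : 2 < p) : Continuous (phi p) := by
  unfold phi
  exact continuous_id.mul ((Real.continuous_rpow_const (by linarith)).comp continuous_abs)

theorem hasDerivAt_phi {p : ℝ} (hp : 2 < p) (x : ℝ) :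
    HasDerivAt (phi p) ((p - 1) * |x| ^ (p - 2)) x := by
  rcases eq_or_ne x 0 with rfl | hx
  -- The difference quotient of `φ` at `0` is `|y|^(p-2)`, which tends to `0`.
  · have hc : Filter.Tendsto (fun y : ℝ => |y| ^ (p - 2)) (nhdsWithin 0 {0}ᶜ)
        (nhds ((p - 1) * |(0 : ℝ)| ^ (p - 2))) := by
      have h : Continuous fun y : ℝ => |y| ^ (p - 2) :=
        (Real.continuous_rpow_const (by linarith)).comp continuous_abs
      have e : (p - 1) * |(0 : ℝ)| ^ (p - 2) = |(0 : ℝ)| ^ (p - 2) := by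
        rw [abs_zero, Real.zero_rpow (by linarith), mul_zero]
      rw [e]
      exact (h.tendsto 0).mono_left nhdsWithin_le_nhds
    rw [hasDerivAt_iff_tendsto_slope]
    refine hc.congr' ?_
    filter_upwards [self_mem_nhdsWithin] with y hy
    have hy' : y ≠ 0 := hy
    simp [slope_def_field, phi]
    field_simp
  · have h1 := (hasDerivAt_abs hx).rpow_const (p := p - 2) (Or.inl (abs_ne_zero.2 hx))
    refine ((hasDerivAt_id x).mul h1).congr_deriv ?_
    have e : |x| ^ (p - 2) = |x| ^ (p - 2 - 1) * |x| := by
      nth_rewrite 3 [← Real.rpow_one |x|]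
      rw [← Real.rpow_add (abs_pos.2 hx)]; congr 1; ring
    have e2 : x * (SignType.sign x : ℝ) = |x| := by rw [mul_comm]; exact sign_mul_self x
    simp only [id]
    calc _ = |x| ^ (p - 2) + (x * (SignType.sign x : ℝ)) * (p - 2) * |x| ^ (p - 2 - 1) := by ring
      _ = _ := by rw [e2, e]; ring

theorem mul_phi {p : ℝ} (hp : 2 < p) (x : ℝ) : x * phi p x = |x| ^ p := by
  unfold phi
  rcases eq_or_ne x 0 with rfl | hx
  · simp [Real.zero_rpow (show p ≠ 0 by linarith)]
  · rw [← mul_assoc, ← sq, ← sq_abs, ← Real.rpow_natCast, ← Real.rpow_add (abs_pos.2 hx)]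
    congr 1; push_cast; ring

theorem abs_phi {p : ℝ} (hp : 2 < p) (x : ℝ) : |phi p x| = |x| ^ (p - 1) := by
  unfold phi
  rcases eq_or_ne x 0 with rfl | hx
  · simp [Real.zero_rpow (show p - 1 ≠ 0 by linarith)]
  · rw [abs_mul, abs_of_nonneg (Real.rpow_nonneg (abs_nonneg x) _)]
    nth_rewrite 1 [← Real.rpow_one |x|]
    rw [← Real.rpow_add (abs_pos.2 hx)]; congr 1; ring

theorem abs_phi_rpow {p q : ℝ} (hp : 2 < p) (hpq : p.HolderConjugate q) (x : ℝ) :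
    |phi p x| ^ q = |x| ^ p := by
  rw [abs_phi hp, ← Real.rpow_mul (abs_nonneg x), hpq.sub_one_mul_conj]

theorem phi_neg (p x : ℝ) : phi p (-x) = -phi p x := by simp [phi]

theorem one_add_phi_pos {p R : ℝ} (hp : 2 < p) (hR : -1 < R) : 0 < 1 + phi p R := by
  rcases le_or_gt 0 R with h | h
  · rw [phi_of_nonneg hp h]
    have := Real.rpow_nonneg h (p - 1)
    linarith
  · have h1 := abs_phi hp R
    have h2 : |R| ^ (p - 1) < 1 :=
      Real.rpow_lt_one (abs_nonneg R) (abs_lt.2 ⟨hR, by linarith⟩) (by linarith)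
    have := (abs_lt.1 (h1.trans_lt h2)).1
    linarith

/-- A function whose derivative increases, decreases and increases again is nonnegative if its
derivative vanishes at two zeros of the function. -/
theorem nonneg_of_deriv_zigzag {G H : ℝ → ℝ} (hG : ∀ x, HasDerivAt G (H x) x) {z₁ z₂ a b : ℝ}
    (h1 : StrictMonoOn H (Iic z₁)) (h2 : StrictAntiOn H (Icc z₁ z₂))
    (h3 : StrictMonoOn H (Ici z₂)) (hab : a < b) (hHa : H a = 0) (hHb : H b = 0)
    (hGa : G a = 0) (hGb : G b = 0) (u : ℝ) : 0 ≤ G u := by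
  have hc : Continuous G := continuous_iff_continuousAt.2 fun x => (hG x).continuousAt
  -- Rolle's theorem supplies a third zero of `H`. Each monotone piece holds at most one zero, so
  -- `a`, `ξ`, `b` lie in the three pieces in this order; this fixes the sign of `H` everywhere and
  -- makes `a` and `b` the minima of `G`.
  obtain ⟨ξ, hξ, hHξ⟩ := exists_hasDerivAt_eq_zero hab hc.continuousOn (hGa.trans hGb.symm)
    (fun x _ => hG x)
  obtain ⟨hξa, hξb⟩ := hξ
  have ha : a ≤ z₁ ∧ z₁ ≤ ξ ∧ ξ ≤ z₂ ∧ z₂ ≤ b := by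
    have i1 : ∀ s t, H s = 0 → H t = 0 → s < t → t ≤ z₁ → False := fun s t hs ht hst h =>
      hst.ne (h1.injOn (mem_Iic.2 (hst.le.trans h)) (mem_Iic.2 h) (hs.trans ht.symm))
    have i2 : ∀ s t, H s = 0 → H t = 0 → s < t → z₁ ≤ s → t ≤ z₂ → False :=
      fun s t hs ht hst h h' =>
        hst.ne (h2.injOn ⟨h, hst.le.trans h'⟩ ⟨h.trans hst.le, h'⟩ (hs.trans ht.symm))
    have i3 : ∀ s t, H s = 0 → H t = 0 → s < t → z₂ ≤ s → False := fun s t hs ht hst h =>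
      hst.ne (h3.injOn (mem_Ici.2 h) (mem_Ici.2 (h.trans hst.le)) (hs.trans ht.symm))
    have j1 : z₁ ≤ ξ := (not_le.1 fun h => i1 a ξ hHa hHξ hξa h).le
    have j2 : ξ ≤ z₂ := (not_le.1 fun h => i3 ξ b hHξ hHb hξb h).le
    exact ⟨(not_le.1 fun h => i2 a ξ hHa hHξ hξa h j2).le, j1, j2,
      (not_le.1 fun h => i2 ξ b hHξ hHb hξb j1 h).le⟩
  obtain ⟨ha1, h1ξ, hξ2, h2b⟩ := ha
  have mono : ∀ s t : ℝ, (∀ x ∈ Ioo s t, 0 ≤ H x) → s ≤ t → G s ≤ G t := fun s t h hst =>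
    monotoneOn_of_deriv_nonneg (convex_Icc s t) hc.continuousOn
      (fun x _ => (hG x).differentiableAt.differentiableWithinAt)
      (fun x hx => by rw [(hG x).deriv]; rw [interior_Icc] at hx; exact h x hx)
      (left_mem_Icc.2 hst) (right_mem_Icc.2 hst) hst
  have anti : ∀ s t : ℝ, (∀ x ∈ Ioo s t, H x ≤ 0) → s ≤ t → G t ≤ G s := fun s t h hst =>
    antitoneOn_of_deriv_nonpos (convex_Icc s t) hc.continuousOn
      (fun x _ => (hG x).differentiableAt.differentiableWithinAt)
      (fun x hx => by rw [(hG x).deriv]; rw [interior_Icc] at hx; exact h x hx)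
      (left_mem_Icc.2 hst) (right_mem_Icc.2 hst) hst
  rcases le_total u a with hu | hu
  · rw [← hGa]
    refine anti u a (fun x hx => ?_) hu
    rw [← hHa]
    exact (h1 (mem_Iic.2 (hx.2.le.trans ha1)) (mem_Iic.2 ha1) hx.2).le
  rcases le_total u ξ with hu' | hu'
  · rw [← hGa]
    refine mono a u (fun x hx => ?_) hu
    rcases le_total x z₁ with hx1 | hx1
    · rw [← hHa]
      exact (h1 (mem_Iic.2 ha1) (mem_Iic.2 hx1) hx.1).le
    · rw [← hHξ]
      exact (h2 ⟨hx1, (hx.2.le.trans hu').trans hξ2⟩ ⟨h1ξ, hξ2⟩ (hx.2.trans_le hu')).le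
  rcases le_total u b with hb | hb
  · rw [← hGb]
    refine anti u b (fun x hx => ?_) hb
    rcases le_total x z₂ with hx1 | hx1
    · rw [← hHξ]
      exact (h2 ⟨h1ξ, hξ2⟩ ⟨h1ξ.trans (hu'.trans hx.1.le), hx1⟩ (hu'.trans_lt hx.1)).le
    · rw [← hHb]
      exact (h3 (mem_Ici.2 hx1) (mem_Ici.2 h2b) hx.2).le
  · rw [← hGb]
    refine mono b u (fun x hx => ?_) hb
    rw [← hHb]
    exact (h3 (mem_Ici.2 h2b) (mem_Ici.2 (h2b.trans hx.1.le)) hx.1).le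

/-- The shape of `c + m φ(u) - φ(1 + (u - 1)/k)`. -/
theorem phi_sub_phi_zigzag {p m k c : ℝ} (hp : 2 < p) (hm : 0 < m) (hk : 1 < k)
    (hmk : 1 < m * k ^ (p - 1)) :
    ∃ z₁ z₂ : ℝ, StrictMonoOn (fun u => c + m * phi p u - phi p (1 + (u - 1) / k)) (Iic z₁) ∧
      StrictAntiOn (fun u => c + m * phi p u - phi p (1 + (u - 1) / k)) (Icc z₁ z₂) ∧
      StrictMonoOn (fun u => c + m * phi p u - phi p (1 + (u - 1) / k)) (Ici z₂) := by
  have hk0 : 0 < k := by linarith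
  have hp2 : 0 < p - 2 := by linarith
  have hmk0 : 0 < m * k := mul_pos hm hk0
  -- With this `s` the sign of the derivative is that of `|u| - s|1 + (u - 1)/k|`, equivalently of
  -- `k|u| - s|u + k - 1|`. The hypothesis `hmk` amounts to `s < k`.
  obtain ⟨s, hs, hsp⟩ : ∃ s : ℝ, 0 < s ∧ s ^ (p - 2) = 1 / (m * k) := by
    refine ⟨(1 / (m * k)) ^ (p - 2)⁻¹, by positivity, ?_⟩
    rw [← Real.rpow_mul (by positivity), inv_mul_cancel₀ hp2.ne', Real.rpow_one]
  have hsk : s < k := by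
    rw [← Real.rpow_lt_rpow_iff hs.le hk0.le hp2, hsp, div_lt_iff₀ hmk0]
    have : k ^ (p - 1) = k ^ (p - 2) * k := by
      nth_rewrite 3 [← Real.rpow_one k]
      rw [← Real.rpow_add hk0]; congr 1; ring
    rw [this] at hmk
    linarith
  have hd : ∀ u : ℝ, HasDerivAt (fun u => c + m * phi p u - phi p (1 + (u - 1) / k))
      ((p - 1) * m * (|u| ^ (p - 2) - (s * |1 + (u - 1) / k|) ^ (p - 2))) u := by
    intro u
    have hw : HasDerivAt (fun u : ℝ => 1 + (u - 1) / k) (1 / k) u :=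
      (((hasDerivAt_id u).sub_const 1).div_const k).const_add 1
    have h := (((hasDerivAt_phi hp u).const_mul m).const_add c).sub
      ((hasDerivAt_phi hp (1 + (u - 1) / k)).comp u hw)
    refine h.congr_deriv ?_
    rw [Real.mul_rpow hs.le (abs_nonneg _), hsp]
    field_simp
  have hcont : Continuous (fun u => c + m * phi p u - phi p (1 + (u - 1) / k)) :=
    continuous_iff_continuousAt.2 fun u => (hd u).continuousAt
  have hw : ∀ u : ℝ, k * |1 + (u - 1) / k| = |u + (k - 1)| := by
    intro u
    nth_rewrite 1 [← abs_of_pos hk0]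
    rw [← abs_mul]; congr 1; field_simp; ring
  have hcoef : 0 < (p - 1) * m := mul_pos (by linarith) hm
  have hpos : ∀ u : ℝ, s * |u + (k - 1)| < k * |u| →
      0 < deriv (fun u => c + m * phi p u - phi p (1 + (u - 1) / k)) u := by
    intro u hu
    rw [(hd u).deriv]
    refine mul_pos hcoef (sub_pos.2 (Real.rpow_lt_rpow (by positivity) ?_ hp2))
    rw [← hw, mul_left_comm] at hu
    exact lt_of_mul_lt_mul_left hu hk0.le
  have hneg : ∀ u : ℝ, k * |u| < s * |u + (k - 1)| →
      deriv (fun u => c + m * phi p u - phi p (1 + (u - 1) / k)) u < 0 := by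
    intro u hu
    rw [(hd u).deriv]
    refine mul_neg_of_pos_of_neg hcoef (sub_neg.2 (Real.rpow_lt_rpow (abs_nonneg u) ?_ hp2))
    rw [← hw, mul_left_comm] at hu
    exact lt_of_mul_lt_mul_left hu hk0.le
  have hsκ : 0 < s * (k - 1) := mul_pos hs (by linarith)
  -- The two solutions of `k|u| = s|u + k - 1|`.
  refine ⟨-(s * (k - 1)) / (k + s), s * (k - 1) / (k - s), ?_, ?_, ?_⟩
  · refine strictMonoOn_of_deriv_pos (convex_Iic _) hcont.continuousOn fun u hu => hpos u ?_
    rw [interior_Iic, mem_Iio, lt_div_iff₀ (by linarith)] at hu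
    have hu0 : u < 0 := by nlinarith
    rw [abs_of_neg hu0, ← abs_of_pos hs, ← abs_mul, abs_lt]
    constructor <;> nlinarith
  · refine strictAntiOn_of_deriv_neg (convex_Icc _ _) hcont.continuousOn fun u hu => hneg u ?_
    rw [interior_Icc, mem_Ioo, lt_div_iff₀ (by linarith), div_lt_iff₀ (by linarith)] at hu
    refine lt_of_lt_of_le ?_ (mul_le_mul_of_nonneg_left (le_abs_self _) hs.le)
    rw [← abs_of_pos hk0, ← abs_mul, abs_of_pos hk0, abs_lt]
    constructor <;> linarith [hu.1, hu.2]
  · refine strictMonoOn_of_deriv_pos (convex_Ici _) hcont.continuousOn fun u hu => hpos u ?_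
    rw [interior_Ici, mem_Ioi, div_lt_iff₀ (by linarith)] at hu
    have hu0 : 0 < u := by
      by_contra h
      nlinarith
    rw [abs_of_pos hu0, abs_of_pos (by linarith)]
    linarith

/-- The derivative simplifies to `(p - 1)(1 + x)^(-p)(x^(p-2) - 1)`. -/
theorem strictAntiOn_one_add_rpow_mul {p : ℝ} (hp : 2 < p) :
    StrictAntiOn (fun x : ℝ => (1 + x ^ (p - 1)) * (1 + x) ^ (1 - p)) (Icc 0 1) := by
  apply strictAntiOn_of_deriv_neg (convex_Icc _ _)
  · apply ContinuousOn.mul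
    · exact (continuous_const.add (Real.continuous_rpow_const (by linarith))).continuousOn
    · apply ContinuousOn.rpow_const (by fun_prop)
      intro x hx
      exact Or.inl (by linarith [hx.1])
  · intro x hx
    rw [interior_Icc] at hx
    have hx1 : 0 < 1 + x := by linarith [hx.1]
    have h3 := Real.hasDerivAt_rpow_const (x := x) (p := p - 1) (Or.inl hx.1.ne')
    have h4 := ((hasDerivAt_id x).const_add 1).rpow_const (p := 1 - p) (Or.inl hx1.ne')
    have h5 := (h3.const_add 1).mul h4
    have e1 : x ^ (p - 1) = x ^ (p - 1 - 1) * x := by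
      nth_rewrite 3 [← Real.rpow_one x]
      rw [← Real.rpow_add hx.1]; congr 1; ring
    have e2 : (1 + x) ^ (1 - p) = (1 + x) ^ (1 - p - 1) * (1 + x) := by
      nth_rewrite 3 [← Real.rpow_one (1 + x)]
      rw [← Real.rpow_add hx1]; congr 1; ring
    have hlt : x ^ (p - 1 - 1) < 1 := Real.rpow_lt_one hx.1.le hx.2 (by linarith)
    have hpos := Real.rpow_pos_of_pos hx1 (1 - p - 1)
    have hv : deriv (fun x : ℝ => (1 + x ^ (p - 1)) * (1 + x) ^ (1 - p)) x
        = (p - 1) * (1 + x) ^ (1 - p - 1) * (x ^ (p - 1 - 1) - 1) := by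
      refine (h5.congr_deriv ?_).deriv
      simp only [id]
      rw [e1, e2]; ring
    rw [hv]
    exact mul_neg_of_pos_of_neg (mul_pos (by linarith) hpos) (by linarith)

/-- Supplies the condition `1 < m k^(p-1)` of `phi_sub_phi_zigzag`. For `R < 0` the two sides are
separated by the value `1` at zero, because `(1 + R)^(p-1) ≤ 1 + R ≤ 1 + φ(R)`. -/
theorem one_add_phi_mul_lt {p R s : ℝ} (hp : 2 < p) (hR : -1 < R) (hRs : R < s) (hs0 : 0 < s)
    (hs1 : s ≤ 1) : (1 + phi p s) * (1 + s) ^ (1 - p) < (1 + phi p R) * (1 + R) ^ (1 - p) := by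
  rw [phi_of_nonneg hp hs0.le]
  rcases le_or_gt 0 R with h | h
  · rw [phi_of_nonneg hp h]
    exact strictAntiOn_one_add_rpow_mul hp ⟨h, (hRs.le.trans hs1)⟩ ⟨hs0.le, hs1⟩ hRs
  · have h0 := strictAntiOn_one_add_rpow_mul hp ⟨le_rfl, zero_le_one⟩ ⟨hs0.le, hs1⟩ hs0
    simp only [Real.zero_rpow (show p - 1 ≠ 0 by linarith), add_zero, Real.one_rpow,
      mul_one] at h0
    refine h0.trans_le ?_
    have hR1 : 0 < 1 + R := by linarith
    have e : (1 + R) ^ (1 - p) = ((1 + R) ^ (p - 1))⁻¹ := by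
      rw [← Real.rpow_neg hR1.le]; congr 1; ring
    rw [e, ← div_eq_mul_inv, one_le_div (Real.rpow_pos_of_pos hR1 _)]
    have h1 : (1 + R) ^ (p - 1) ≤ 1 + R := by
      have := Real.rpow_le_rpow_of_exponent_ge hR1 (by linarith) (show 1 ≤ p - 1 by linarith)
      rwa [Real.rpow_one] at this
    have h2 : phi p R = -(-R) ^ (p - 1) := by
      rw [← phi_of_nonneg hp (by linarith : 0 ≤ -R), phi_neg, neg_neg]
    have h3 : (-R) ^ (p - 1) ≤ -R := by
      have := Real.rpow_le_rpow_of_exponent_ge (neg_pos.2 h) (by linarith)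
        (show 1 ≤ p - 1 by linarith)
      rwa [Real.rpow_one] at this
    linarith

/-! ### Touching conditions and construction of the majorant -/

theorem lam_of_gt {p R : ℝ} (hR : -1 < R) :
    lam p R = 1 / (1 + R) - (p - 1) / (1 + phi p R) := if_neg hR.ne'

/-- The relation that makes the majorant touch at the second endpoint. -/
theorem touching_identity {p R s : ℝ} (hp : 2 < p) (hR : -1 < R) (hs : -1 < s)
    (h : lam p s = lam p R) {m k : ℝ} (hm : m = (1 + phi p R) / (1 + phi p s))
    (hk : k = (1 + s) / (1 + R)) :
    p * (1 - m) * (1 + s) + m * (1 - s * phi p s) - k * (1 - R * phi p R) = 0 := by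
  have h1 := one_add_phi_pos hp hR
  have h2 := one_add_phi_pos hp hs
  have hR1 : 0 < 1 + R := by linarith
  have hs1 : 0 < 1 + s := by linarith
  rw [lam_of_gt hR, lam_of_gt hs] at h
  generalize phi p R = A at *
  generalize phi p s = B at *
  -- The left side is a multiple of `λ(s) - λ(R)`.
  have key : (p * (1 - m) * (1 + s) + m * (1 - s * B) - k * (1 - R * A))
      = (1 + A) * (1 + s) * ((1 / (1 + s) - (p - 1) / (1 + B)) - (1 / (1 + R) - (p - 1) / (1 + A)))
      := by
    subst hm hk
    field_simp
    ring
  rw [key, h]; ring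

/-- The majorant is the sum of Young's inequality for `(w, v)`, `w = 1 + (u - 1)/k`, multiplied by
`k`, and of `G(u)/p ≥ 0`. Both are equalities at the two touching points, since there `v = φ(w)` and
`G(u) = 0`. -/
theorem exists_majorant {p q R : ℝ} (hp : 2 < p) (hpq : p.HolderConjugate q) (hR : -1 < R)
    (hR1 : R ≤ 1) :
    ∃ c₀ c₁ c₂ c₃ c₄ : ℝ,
      (∀ u v : ℝ, u * v ≤ c₀ + c₁ * u + c₂ * v + c₃ * |u| ^ p + c₄ * |v| ^ q) ∧
      c₀ + c₁ + c₂ + c₃ + c₄ = 1 ∧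
      c₀ + c₁ * -rho p R + c₂ * -phi p R + c₃ * |rho p R| ^ p + c₄ * |R| ^ p
        = rho p R * phi p R := by
  have hp0 : 0 < p := by linarith
  have hq0 := hpq.symm.pos
  have hR0 := R0_mem hp
  have hρ := rho_mem hp ⟨hR.le, hR1⟩
  set s := rho p R with hs
  have hs0 : 0 < s := hR0.1.trans_le hρ.1
  have hlam : lam p s = lam p R := by
    rcases le_total R (R0 p) with h | h
    · exact lam_rho hp ⟨hR.le, h⟩
    · rw [hs, rho_of_ge hp h]
  have hA := one_add_phi_pos hp hR
  have hB := one_add_phi_pos hp (show -1 < s by linarith)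
  have hRp : 0 < 1 + R := by linarith
  -- `k` is chosen so that `u = -s` corresponds to `w = -R`, and `m` so that `G'(-s) = 0`.
  obtain ⟨m, hm⟩ : ∃ m, m = (1 + phi p R) / (1 + phi p s) := ⟨_, rfl⟩
  obtain ⟨k, hk⟩ : ∃ k, k = (1 + s) / (1 + R) := ⟨_, rfl⟩
  have hid := touching_identity hp hR (show -1 < s by linarith) hlam hm hk
  have hm0 : 0 < m := by rw [hm]; positivity
  have hk0 : 0 < k := by rw [hk]; positivity
  have hqi : 1 / q = 1 - 1 / p := by
    have := hpq.inv_add_inv_eq_one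
    rw [one_div, one_div]; linarith
  have hmB : m * (1 + phi p s) = 1 + phi p R := by rw [hm]; field_simp
  have hkR : k * (1 + R) = 1 + s := by rw [hk]; field_simp
  have hw : 1 + (-s - 1) / k = -R := by rw [hk]; field_simp; ring
  -- This is `G(u)`; its constant and linear coefficients are those for which `G(1) = G'(1) = 0`.
  have hG : ∀ u : ℝ, 0 ≤ (k - m - p * (1 - m)) + p * (1 - m) * u + m * |u| ^ p
      - k * |1 + (u - 1) / k| ^ p := by
    rcases lt_or_ge R (R0 p) with hlt | hge
    · have hRs : R < s := hlt.trans_le hρ.1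
      have hk1 : 1 < k := by rw [hk, one_lt_div hRp]; linarith
      have hmk : 1 < m * k ^ (p - 1) := by
        have hlt := one_add_phi_mul_lt hp hR hRs hs0 hρ.2
        have e1 : ∀ y : ℝ, 0 < y → y ^ (1 - p) = (y ^ (p - 1))⁻¹ := fun y hy => by
          rw [← Real.rpow_neg hy.le]; congr 1; ring
        have hs1 : 0 < 1 + s := by linarith
        rw [e1 _ hs1, e1 _ hRp, ← div_eq_mul_inv, ← div_eq_mul_inv,
          div_lt_div_iff₀ (Real.rpow_pos_of_pos hs1 _) (Real.rpow_pos_of_pos hRp _)] at hlt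
        rw [hm, hk, Real.div_rpow hs1.le hRp.le, div_mul_div_comm,
          one_lt_div (mul_pos hB (Real.rpow_pos_of_pos hRp _))]
        exact hlt
      obtain ⟨z₁, z₂, h1, h2, h3⟩ := phi_sub_phi_zigzag (c := 1 - m) hp hm0 hk1 hmk
      have hd : ∀ u : ℝ, HasDerivAt (fun u => ((k - m - p * (1 - m)) + p * (1 - m) * u
          + m * |u| ^ p - k * |1 + (u - 1) / k| ^ p) / p)
          (1 - m + m * phi p u - phi p (1 + (u - 1) / k)) u := by
        intro u
        have hw : HasDerivAt (fun u : ℝ => 1 + (u - 1) / k) (1 / k) u :=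
          (((hasDerivAt_id u).sub_const 1).div_const k).const_add 1
        have i1 := (hasDerivAt_abs_rpow u (show 1 < p by linarith)).const_mul m
        have i2 := ((hasDerivAt_abs_rpow (1 + (u - 1) / k)
          (show 1 < p by linarith)).comp u hw).const_mul k
        have i3 := ((hasDerivAt_id u).const_mul (p * (1 - m))).const_add (k - m - p * (1 - m))
        refine (((i3.add i1).sub i2).div_const p).congr_deriv ?_
        unfold phi
        field_simp
      have hA1 := phi_of_nonneg hp (zero_le_one (α := ℝ))
      rw [Real.one_rpow] at hA1
      intro u
      have := nonneg_of_deriv_zigzag hd h1 h2 h3 (show -s < 1 by linarith)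
        (by rw [hw, phi_neg, phi_neg]; linarith) (by simp [hA1])
        (by
          rw [hw, abs_neg, abs_neg, ← mul_phi hp s, ← mul_phi hp R, div_eq_zero_iff]
          left; linarith)
        (by simp) u
      rw [le_div_iff₀ hp0] at this
      linarith
    · have e : s = R := rho_of_ge hp hge
      have hm1 : m = 1 := by rw [hm, e]; exact div_self hA.ne'
      have hk1 : k = 1 := by rw [hk, e]; exact div_self hRp.ne'
      intro u
      rw [hm1, hk1]
      simp
  refine ⟨(k - m - p * (1 - m)) / p, 1 - m, 1 - k, m / p, k / q, ?_, ?_, ?_⟩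
  · intro u v
    -- Because `k w = u - (1 - k)`, the product `k w v` differs from `uv` only by a term linear in
    -- `v`.
    have hy := mul_le_mul_of_nonneg_left (Real.young_inequality (1 + (u - 1) / k) v hpq) hk0.le
    have e : k * ((1 + (u - 1) / k) * v) = u * v - (1 - k) * v := by field_simp; ring
    rw [e] at hy
    have hg := div_nonneg (hG u) hp0.le
    have e2 : ((k - m - p * (1 - m)) + p * (1 - m) * u + m * |u| ^ p
        - k * |1 + (u - 1) / k| ^ p) / p = (k - m - p * (1 - m)) / p + (1 - m) * u
        + m / p * |u| ^ p - k * |1 + (u - 1) / k| ^ p / p := by field_simp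
    have e3 : k * (|1 + (u - 1) / k| ^ p / p + |v| ^ q / q)
        = k * |1 + (u - 1) / k| ^ p / p + k / q * |v| ^ q := by ring
    rw [e3] at hy
    rw [e2] at hg
    linarith
  · rw [div_eq_mul_one_div k q, hqi]; field_simp; ring
  · rw [← mul_phi hp s, ← mul_phi hp R, div_eq_mul_one_div k q, hqi]
    have e : k = 1 + s - k * R := by linarith
    field_simp
    linear_combination (-1) * hid + p * phi p R * hkR

/-! ### The values of the Bellman function on the segments -/

theorem rho_neg_one {p : ℝ} (hp : 2 < p) : rho p (-1) = 1 := by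
  have hR0 := R0_mem hp
  refine (rho_unique hp ⟨le_rfl, by linarith [hR0.1]⟩ ⟨hR0.2.le, le_rfl⟩ ?_).symm
  rw [lam_one hp]; simp [lam]

/-- The majorant is exact at both endpoints and affine, hence exact along the segment, where it
meets the two-valued competitors. -/
theorem bellmanC_segment {p q α β : ℝ} (hp : 2 < p) (hpq : p.HolderConjugate q) (hαβ : α < β)
    {R : ℝ} (hR : R ∈ Icc (-1 : ℝ) 1) {a₁ a₂ : ℝ} (ha : 0 < a₁ * a₂) {τ : ℝ}
    (hτ : τ ∈ Icc (0 : ℝ) 1) :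
    bellmanC p q α β (τ • endpointA p q a₁ a₂ + (1 - τ) • endpointB p q a₁ a₂ R)
      = ((a₁ * a₂ * (τ + (1 - τ) * (rho p R * phi p R)) : ℝ) : EReal) := by
  have ha1 : a₁ ≠ 0 := left_ne_zero_of_mul ha.ne'
  have ha2 : a₂ ≠ 0 := right_ne_zero_of_mul ha.ne'
  have hP : 0 < |a₁| ^ p := Real.rpow_pos_of_pos (abs_pos.2 ha1) p
  have hQ : 0 < |a₂| ^ q := Real.rpow_pos_of_pos (abs_pos.2 ha2) q
  apply le_antisymm
  · rcases hR.1.eq_or_lt with rfl | hR1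
    -- At `R = -1` both endpoints have second coordinate `a₂` and fourth coordinate `|a₂|^q`, so `g`
    -- is forced to be constant.
    · have hφ : phi p (-1) = -1 := by simp [phi]
      have hx1 : (τ • endpointA p q a₁ a₂ + (1 - τ) • endpointB p q a₁ a₂ (-1)) 1 = a₂ := by
        simp [endpointA, endpointB, hφ]; ring
      refine (bellmanC_le_of_boundary hpq hαβ (by rw [hx1]; exact ha2) ?_).trans_eq ?_
      · rw [hx1]; simp [endpointA, endpointB]; ring
      · rw [hx1, hφ, rho_neg_one hp]
        congr 1
        simp [endpointA, endpointB, rho_neg_one hp]; ring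
    · obtain ⟨c₀, c₁, c₂, c₃, c₄, h, hA, hB⟩ := exists_majorant hp hpq hR1 hR.2
      -- The normalized majorant at `(u/a₁, v/a₂)`, multiplied by `a₁a₂ > 0`.
      have h' : ∀ u v : ℝ, u * v ≤ a₁ * a₂ * c₀ + a₂ * c₁ * u + a₁ * c₂ * v
          + a₁ * a₂ * c₃ / |a₁| ^ p * |u| ^ p + a₁ * a₂ * c₄ / |a₂| ^ q * |v| ^ q := by
        intro u v
        have := mul_le_mul_of_nonneg_left (h (u / a₁) (v / a₂)) ha.le
        rw [abs_div, abs_div, Real.div_rpow (abs_nonneg _) (abs_nonneg _),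
          Real.div_rpow (abs_nonneg _) (abs_nonneg _)] at this
        calc u * v = a₁ * a₂ * (u / a₁ * (v / a₂)) := by field_simp
          _ ≤ _ := this
          _ = _ := by field_simp
      refine (bellmanC_le_of_majorant hpq hαβ h' _).trans_eq ?_
      congr 1
      simp only [endpointA, endpointB, Pi.add_apply, Pi.smul_apply, smul_eq_mul,
        Matrix.cons_val, abs_mul, Real.mul_rpow (abs_nonneg _) (abs_nonneg _)]
      field_simp
      linear_combination τ * hA + (1 - τ) * hB
  · have h := le_bellmanC (p := p) (q := q) hαβ hτ
      (x := τ • endpointA p q a₁ a₂ + (1 - τ) • endpointB p q a₁ a₂ R)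
      a₁ a₂ (-rho p R * a₁) (-phi p R * a₂) (by simp [endpointA, endpointB])
      (by simp [endpointA, endpointB]) (by simp [endpointA, endpointB])
      (by
        rw [abs_mul, Real.mul_rpow (abs_nonneg _) (abs_nonneg _), abs_neg,
          abs_phi_rpow hp hpq]
        simp [endpointA, endpointB])
    refine le_trans (le_of_eq ?_) h
    congr 1
    ring

/-- Here `ρ(R) = R`, so the third and fourth coordinates are `|a₁|^p D` and `|a₂|^q D` with the same
`D = τ + (1 - τ)R^p`, and the value is `a₁a₂D`. -/
theorem bellmanC_of_mem_ellC {p q α β : ℝ} (hp : 2 < p) (hpq : p.HolderConjugate q)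
    (hαβ : α < β) {R : ℝ} (hR : R ∈ Icc (R0 p) 1) {a₁ a₂ : ℝ} (ha : 0 < a₁ * a₂)
    {x : Fin 4 → ℝ} (hx : x ∈ ellC p q a₁ a₂ R) :
    bellmanC p q α β x = ((x 2 ^ (1 / p) * x 3 ^ (1 / q) : ℝ) : EReal) := by
  obtain ⟨τ, σ, hτ, hσ, hsum, rfl⟩ := hx
  obtain rfl : σ = 1 - τ := by linarith
  have hR0 := R0_mem hp
  have hRpos : 0 < R := hR0.1.trans_le hR.1
  rw [bellmanC_segment hp hpq hαβ ⟨by linarith, hR.2⟩ ha ⟨hτ, by linarith⟩, rho_of_ge hp hR.1,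
    mul_phi hp]
  congr 1
  have hD : 0 ≤ τ + (1 - τ) * |R| ^ p :=
    add_nonneg hτ (mul_nonneg hσ (Real.rpow_nonneg (abs_nonneg R) p))
  have e2 : (τ • endpointA p q a₁ a₂ + (1 - τ) • endpointB p q a₁ a₂ R) 2
      = |a₁| ^ p * (τ + (1 - τ) * |R| ^ p) := by
    simp [endpointA, endpointB, rho_of_ge hp hR.1, abs_mul,
      Real.mul_rpow (abs_nonneg _) (abs_nonneg _)]
    ring
  have e3 : (τ • endpointA p q a₁ a₂ + (1 - τ) • endpointB p q a₁ a₂ R) 3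
      = |a₂| ^ q * (τ + (1 - τ) * |R| ^ p) := by
    simp [endpointA, endpointB]
    ring
  have hqi : 1 / q = 1 - 1 / p := by
    have := hpq.inv_add_inv_eq_one
    rw [one_div, one_div]; linarith
  rw [e2, e3, Real.mul_rpow (Real.rpow_nonneg (abs_nonneg _) _) hD,
    Real.mul_rpow (Real.rpow_nonneg (abs_nonneg _) _) hD, ← Real.rpow_mul (abs_nonneg _),
    ← Real.rpow_mul (abs_nonneg _), mul_one_div_cancel hpq.ne_zero,
    mul_one_div_cancel hpq.symm.ne_zero, Real.rpow_one, Real.rpow_one, mul_mul_mul_comm,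
    ← abs_mul, abs_of_pos ha, ← Real.rpow_add' hD (by rw [hqi]; norm_num), hqi,
    add_sub_cancel, Real.rpow_one]

/-! ### The segments cover the domain -/

/-- Any cluster point of `t` at `x` lies in `K` and is a zero of `F (x, ·)`, hence equals `t x`; in
a compact set a unique cluster point is a limit. -/
theorem continuousOn_of_unique_zero {F : ℝ × ℝ → ℝ} {t : ℝ → ℝ} {S K : Set ℝ}
    (hK : IsCompact K) (hF : ContinuousOn F (S ×ˢ K)) (ht : ∀ x ∈ S, t x ∈ K)
    (h0 : ∀ x ∈ S, F (x, t x) = 0) (hu : ∀ x ∈ S, ∀ y ∈ K, F (x, y) = 0 → y = t x) :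
    ContinuousOn t S := by
  intro x hx
  refine hK.tendsto_nhds_of_unique_mapClusterPt (eventually_nhdsWithin_of_forall ht)
    fun y hy hc => hu x hx y hy ?_
  obtain ⟨U, hU, hUt⟩ := mapClusterPt_iff_ultrafilter.1 hc
  have hmem : ∀ᶠ z in (U : Filter ℝ), z ∈ S := hU self_mem_nhdsWithin
  have h1 : Filter.Tendsto (fun z => (z, t z)) U (nhdsWithin (x, y) (S ×ˢ K)) := by
    refine tendsto_nhdsWithin_iff.2 ⟨?_, hmem.mono fun z hz => ⟨hz, ht z hz⟩⟩
    exact Filter.Tendsto.prodMk_nhds (hU.trans nhdsWithin_le_nhds) hUt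
  have h2 := (hF (x, y) ⟨hx, hy⟩).tendsto.comp h1
  exact tendsto_nhds_unique h2
    (tendsto_const_nhds.congr' (hmem.mono fun z hz => (h0 z hz).symm))

/-- Staying away from `-1` avoids the point where `λ` has a separately assigned value. -/
theorem continuousOn_rho {p R₁ : ℝ} (hp : 2 < p) (hR₁ : -1 < R₁) (hR₁' : R₁ ≤ R0 p) :
    ContinuousOn (rho p) (Icc R₁ 1) := by
  have hR0 := R0_mem hp
  rw [← Icc_union_Icc_eq_Icc hR₁' hR0.2.le]
  refine ContinuousOn.union_of_isClosed ?_ ?_ isClosed_Icc isClosed_Icc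
  · have hlam : ContinuousOn (lam p) (Icc R₁ (R0 p)) := by
      have : ContinuousOn (fun R => 1 / (1 + R) - (p - 1) / (1 + phi p R)) (Icc R₁ (R0 p)) := by
        apply ContinuousOn.sub
        · refine continuousOn_const.div (by fun_prop) fun R hR => ?_
          linarith [hR.1]
        · refine continuousOn_const.div (continuous_const.add (continuous_phi hp)).continuousOn
            fun R hR => ?_
          exact (one_add_phi_pos hp (hR₁.trans_le hR.1)).ne'
      exact this.congr fun R hR => lam_of_gt (hR₁.trans_le hR.1)
    have hlam' : ContinuousOn (lam p) (Icc (R0 p) 1) :=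
      (lam_continuousOn hp).mono (Icc_subset_Icc_left hR0.1.le)
    have hmem : ∀ x ∈ Icc R₁ (R0 p), x ∈ Icc (-1) (R0 p) := fun x hx =>
      ⟨hR₁.le.trans hx.1, hx.2⟩
    refine continuousOn_of_unique_zero (F := fun z => lam p z.2 - lam p z.1)
      (K := Icc (R0 p) 1) isCompact_Icc ?_ (fun x hx => (rho_spec hp (hmem x hx)).1)
      (fun x hx => sub_eq_zero.2 (lam_rho hp (hmem x hx)))
      (fun x hx y hy h => rho_unique hp (hmem x hx) hy (sub_eq_zero.1 h))
    exact (hlam'.comp continuousOn_snd fun z hz => hz.2).sub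
      (hlam.comp continuousOn_fst fun z hz => hz.1)
  · exact continuousOn_id.congr fun R hR => rho_of_ge hp hR.1

/-! ### The normalized coordinates along a segment -/

/-- The ratio `x₁ / x₃^(1/p)` at the point of a segment with parameter `τ`, where `s = ρ(R)`. -/
noncomputable def firstRatio (p s τ : ℝ) : ℝ := (τ - (1 - τ) * s) / (τ + (1 - τ) * s ^ p) ^ (1 / p)

theorem interp_pos {s τ : ℝ} (hs : 0 < s) (hτ : τ ∈ Icc (0 : ℝ) 1) : 0 < τ + (1 - τ) * s := by
  rcases hτ.1.eq_or_lt with rfl | h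
  · simpa using hs
  · have := mul_nonneg (sub_nonneg.2 hτ.2) hs.le
    linarith

/-- With numerator `N` and `D = τ + (1 - τ)s^p`, the derivative has the sign of `(1 + s)D - N(1 -
s^p)/p`, positive since `N ≤ D` and `1 - s^p < (1 + s)p`. -/
theorem strictMonoOn_firstRatio {p s : ℝ} (hp : 1 < p) (hs0 : 0 < s) (hs1 : s ≤ 1) :
    StrictMonoOn (firstRatio p s) (Icc 0 1) := by
  have hP : 0 < s ^ p := Real.rpow_pos_of_pos hs0 p
  have hP1 : s ^ p ≤ 1 := Real.rpow_le_one hs0.le hs1 (by linarith)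
  have hd : ∀ τ ∈ Icc (0 : ℝ) 1, HasDerivAt (firstRatio p s)
      ((τ + (1 - τ) * s ^ p) ^ (-(1 / p) - 1) *
        ((1 + s) * (τ + (1 - τ) * s ^ p) - (τ - (1 - τ) * s) * (1 - s ^ p) / p)) τ := by
    intro τ hτ
    have hD := interp_pos hP hτ
    have i0 : HasDerivAt (fun τ : ℝ => 1 - τ) (-1) τ := (hasDerivAt_id τ).const_sub 1
    have i1 := (hasDerivAt_id τ).sub (i0.mul_const s)
    have i2 := (hasDerivAt_id τ).add (i0.mul_const (s ^ p))
    have i3 := i1.mul (i2.rpow_const (p := -(1 / p)) (Or.inl hD.ne'))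
    have i4 := i3.congr_of_eventuallyEq (f₁ := firstRatio p s) (by
      filter_upwards [i2.continuousAt.eventually (lt_mem_nhds hD)] with y hy
      have hy' : 0 < y + (1 - y) * s ^ p := hy
      change firstRatio p s y = (y - (1 - y) * s) * (y + (1 - y) * s ^ p) ^ (-(1 / p))
      rw [Real.rpow_neg hy'.le]
      rfl)
    refine i4.congr_deriv ?_
    have e : (τ + (1 - τ) * s ^ p) ^ (-(1 / p))
        = (τ + (1 - τ) * s ^ p) ^ (-(1 / p) - 1) * (τ + (1 - τ) * s ^ p) := by
      nth_rewrite 3 [← Real.rpow_one (τ + (1 - τ) * s ^ p)]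
      rw [← Real.rpow_add hD]; congr 1; ring
    simp only [id, Pi.add_apply, Pi.sub_apply]
    rw [e]
    field_simp
    ring
  refine strictMonoOn_of_deriv_pos (convex_Icc _ _)
    (fun τ hτ => (hd τ hτ).continuousAt.continuousWithinAt) fun τ hτ => ?_
  have hτ' := interior_subset hτ
  have hD := interp_pos hP hτ'
  rw [(hd τ hτ').deriv]
  refine mul_pos (Real.rpow_pos_of_pos hD _) (sub_pos.2 ?_)
  have hND : τ - (1 - τ) * s ≤ τ + (1 - τ) * s ^ p := by
    have h1 := mul_nonneg (sub_nonneg.2 hτ'.2) hs0.le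
    have h2 := mul_nonneg (sub_nonneg.2 hτ'.2) hP.le
    linarith
  rw [div_lt_iff₀ (by linarith)]
  calc (τ - (1 - τ) * s) * (1 - s ^ p) ≤ (τ + (1 - τ) * s ^ p) * (1 - s ^ p) :=
        mul_le_mul_of_nonneg_right hND (by linarith)
    _ < (τ + (1 - τ) * s ^ p) * ((1 + s) * p) := by
        refine mul_lt_mul_of_pos_left ?_ hD
        nlinarith
    _ = _ := by ring

theorem continuousOn_firstRatio {p a : ℝ} (hp : 0 < p) (ha : 0 < a) :
    ContinuousOn (fun z : ℝ × ℝ => firstRatio p z.1 z.2) (Icc a 1 ×ˢ Icc 0 1) := by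
  have hpos : ∀ z ∈ Icc a 1 ×ˢ Icc (0 : ℝ) 1, 0 < z.2 + (1 - z.2) * z.1 ^ p := fun z hz =>
    interp_pos (Real.rpow_pos_of_pos (ha.trans_le hz.1.1) p) hz.2
  have hr : Continuous fun z : ℝ × ℝ => z.1 ^ p := continuous_fst.rpow_const fun _ => Or.inr hp.le
  refine ContinuousOn.div (by fun_prop) (ContinuousOn.rpow_const (by fun_prop) fun z hz =>
    Or.inl (hpos z hz).ne') fun z hz => (Real.rpow_pos_of_pos (hpos z hz) _).ne'

theorem firstRatio_zero {p s : ℝ} (hp : p ≠ 0) (hs : 0 < s) : firstRatio p s 0 = -1 := by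
  have : firstRatio p s 0 = -s / (s ^ p) ^ (1 / p) := by simp [firstRatio]
  rw [this, ← Real.rpow_mul hs.le, mul_one_div_cancel hp, Real.rpow_one, neg_div,
    div_self hs.ne']

theorem firstRatio_one (p s : ℝ) : firstRatio p s 1 = 1 := by simp [firstRatio]

/-- Fix the first ratio by taking `τ = T(ρ(R))` and vary `R`: at `R = 1` the second ratio equals `y₁
≤ y₂`, and near `R = -1` it is at least `y₂`. -/
theorem exists_ratios_eq {p q : ℝ} (hp : 2 < p) (hpq : p.HolderConjugate q) {y₁ y₂ : ℝ}
    (h1 : -1 < y₁) (h12 : y₁ ≤ y₂) (h2 : y₂ < 1) :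
    ∃ R ∈ Icc (-1 : ℝ) 1, ∃ τ ∈ Ioc (0 : ℝ) 1, firstRatio p (rho p R) τ = y₁ ∧
      (τ - (1 - τ) * phi p R) / (τ + (1 - τ) * |R| ^ p) ^ (1 / q) = y₂ := by
  have hp0 : 0 < p := by linarith
  have hR0 := R0_mem hp
  have hex : ∀ s ∈ Icc (R0 p) 1, ∃ τ ∈ Icc (0 : ℝ) 1, firstRatio p s τ = y₁ := by
    intro s hs
    have hs0 : 0 < s := hR0.1.trans_le hs.1
    have hc : ContinuousOn (firstRatio p s) (Icc 0 1) :=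
      (continuousOn_firstRatio hp0 hR0.1).comp (f := fun τ => (s, τ)) (by fun_prop)
        fun τ hτ => ⟨hs, hτ⟩
    refine intermediate_value_Icc zero_le_one hc ⟨?_, ?_⟩
    · rw [firstRatio_zero hp0.ne' hs0]; exact h1.le
    · rw [firstRatio_one]; linarith
  choose! T hT hTy using hex
  have hTpos : ∀ s ∈ Icc (R0 p) 1, 0 < T s := by
    intro s hs
    refine (hT s hs).1.lt_of_ne fun h => ?_
    have := hTy s hs
    rw [← h, firstRatio_zero hp0.ne' (hR0.1.trans_le hs.1)] at this
    linarith
  have hTc : ContinuousOn T (Icc (R0 p) 1) := by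
    refine continuousOn_of_unique_zero (F := fun z => firstRatio p z.1 z.2 - y₁)
      (K := Icc 0 1) isCompact_Icc
      ((continuousOn_firstRatio hp0 hR0.1).sub continuousOn_const) hT
      (fun s hs => sub_eq_zero.2 (hTy s hs)) fun s hs τ hτ h => ?_
    exact (strictMonoOn_firstRatio (by linarith) (hR0.1.trans_le hs.1) hs.2).injOn hτ (hT s hs)
      ((sub_eq_zero.1 h).trans (hTy s hs).symm)
  -- Stopping at `-r` rather than `-1` requires no continuity of `ρ` at `-1`; the maximum with `1/2`
  -- keeps `r` positive when `y₂ ≤ 0`.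
  obtain ⟨r, hr0, hr1, hr⟩ : ∃ r : ℝ, 0 < r ∧ r < 1 ∧ y₂ ≤ r ^ (p - 1) := by
    have hc : 0 < max y₂ (1 / 2) := lt_max_of_lt_right (by norm_num)
    refine ⟨max y₂ (1 / 2) ^ (p - 1)⁻¹, Real.rpow_pos_of_pos hc _,
      Real.rpow_lt_one hc.le (max_lt h2 (by norm_num)) (inv_pos.2 (by linarith)), ?_⟩
    rw [← Real.rpow_mul hc.le, inv_mul_cancel₀ (by linarith), Real.rpow_one]
    exact le_max_left _ _
  have hsub : ∀ R ∈ Icc (-r) 1, R ∈ Icc (-1 : ℝ) 1 := fun R hR => ⟨by linarith [hR.1], hR.2⟩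
  have hD : ∀ R : ℝ, ∀ τ ∈ Ioc (0 : ℝ) 1, 0 < τ + (1 - τ) * |R| ^ p := fun R τ hτ =>
    add_pos_of_pos_of_nonneg hτ.1
      (mul_nonneg (sub_nonneg.2 hτ.2) (Real.rpow_nonneg (abs_nonneg R) p))
  have hτmem : ∀ R ∈ Icc (-r) 1, T (rho p R) ∈ Ioc (0 : ℝ) 1 := fun R hR =>
    ⟨hTpos _ (rho_mem hp (hsub R hR)), (hT _ (rho_mem hp (hsub R hR))).2⟩
  have hτc : ContinuousOn (fun R => T (rho p R)) (Icc (-r) 1) :=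
    hTc.comp (continuousOn_rho hp (by linarith) (by linarith [hR0.1]))
      fun R hR => rho_mem hp (hsub R hR)
  have hφ := (continuous_phi hp).continuousOn (s := Icc (-r) 1)
  have ha : ContinuousOn (fun R : ℝ => |R| ^ p) (Icc (-r) 1) :=
    ((Real.continuous_rpow_const hp0.le).comp continuous_abs).continuousOn
  have hgc : ContinuousOn (fun R => (T (rho p R) - (1 - T (rho p R)) * phi p R)
      / (T (rho p R) + (1 - T (rho p R)) * |R| ^ p) ^ (1 / q)) (Icc (-r) 1) := by
    refine ContinuousOn.div (hτc.sub ((continuousOn_const.sub hτc).mul hφ))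
      (ContinuousOn.rpow_const (hτc.add ((continuousOn_const.sub hτc).mul ha))
        fun R hR => Or.inl (hD R _ (hτmem R hR)).ne')
      fun R hR => (Real.rpow_pos_of_pos (hD R _ (hτmem R hR)) _).ne'
  -- At `R = -r` the numerator `τ + (1 - τ)r^(p-1)` is at least `r^(p-1) ≥ y₂`, and the denominator
  -- is at most `1`.
  obtain ⟨R, hR, hRy⟩ := intermediate_value_Icc' (show -r ≤ 1 by linarith) hgc
    (show y₂ ∈ Icc _ _ from ⟨by
      have h := hTy 1 ⟨hR0.2.le, le_rfl⟩
      have hφ1 := phi_of_nonneg hp (zero_le_one (α := ℝ))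
      rw [Real.one_rpow] at hφ1
      simp only [firstRatio, Real.one_rpow, mul_one, add_sub_cancel, div_one] at h
      simp only [rho_of_ge hp hR0.2.le, hφ1, abs_one, Real.one_rpow, mul_one, add_sub_cancel,
        div_one]
      linarith, by
      have hm : -r ∈ Icc (-r) 1 := ⟨le_rfl, by linarith⟩
      have hτ := hτmem (-r) hm
      have hDp := hD (-r) _ hτ
      simp only [phi_neg, phi_of_nonneg hp hr0.le]
      set τ := T (rho p (-r))
      have hrp : r ^ (p - 1) ≤ 1 := Real.rpow_le_one hr0.le hr1.le (by linarith)
      have hrp0 : 0 < r ^ (p - 1) := Real.rpow_pos_of_pos hr0 _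
      have hrP : |(-r)| ^ p ≤ 1 := by
        rw [abs_neg, abs_of_pos hr0]
        exact Real.rpow_le_one hr0.le hr1.le hp0.le
      have hD1 : τ + (1 - τ) * |(-r)| ^ p ≤ 1 := by
        have := mul_le_mul_of_nonneg_left hrP (sub_nonneg.2 hτ.2)
        linarith
      have hn : r ^ (p - 1) ≤ τ - (1 - τ) * -r ^ (p - 1) := by
        have := mul_nonneg hτ.1.le (sub_nonneg.2 hrp)
        linarith
      rw [le_div_iff₀ (Real.rpow_pos_of_pos hDp _)]
      have hE0 := Real.rpow_pos_of_pos hDp (1 / q)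
      have hE1 : (τ + (1 - τ) * |(-r)| ^ p) ^ (1 / q) ≤ 1 :=
        Real.rpow_le_one hDp.le hD1 (one_div_nonneg.2 hpq.symm.nonneg)
      calc y₂ * (τ + (1 - τ) * |(-r)| ^ p) ^ (1 / q)
          ≤ r ^ (p - 1) * (τ + (1 - τ) * |(-r)| ^ p) ^ (1 / q) :=
            mul_le_mul_of_nonneg_right hr hE0.le
        _ ≤ r ^ (p - 1) := mul_le_of_le_one_right hrp0.le hE1
        _ ≤ _ := hn⟩)
  exact ⟨R, hsub R hR, T (rho p R), hτmem R hR, hTy _ (rho_mem hp (hsub R hR)), hRy⟩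

/-- The ratios determine `R` and `τ`; the third and fourth coordinates then give the scales `a₁` and
`a₂`. -/
theorem exists_mem_ellC {p q : ℝ} (hp : 2 < p) (hpq : p.HolderConjugate q) {x : Fin 4 → ℝ}
    (hx2 : 0 < x 2) (hx3 : 0 < x 3) (h1 : -1 < x 0 / x 2 ^ (1 / p))
    (h12 : x 0 / x 2 ^ (1 / p) ≤ x 1 / x 3 ^ (1 / q)) (h2 : x 1 / x 3 ^ (1 / q) < 1) :
    ∃ a₁ a₂ R : ℝ, 0 < a₁ ∧ 0 < a₂ ∧ R ∈ Icc (-1 : ℝ) 1 ∧ x ∈ ellC p q a₁ a₂ R := by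
  obtain ⟨R, hR, τ, hτ, e1, e2⟩ := exists_ratios_eq hp hpq h1 h12 h2
  have hρ0 : 0 < rho p R := (R0_mem hp).1.trans_le (rho_mem hp hR).1
  have hD1 : 0 < τ + (1 - τ) * rho p R ^ p :=
    interp_pos (Real.rpow_pos_of_pos hρ0 p) ⟨hτ.1.le, hτ.2⟩
  have hD2 : 0 < τ + (1 - τ) * |R| ^ p := add_pos_of_pos_of_nonneg hτ.1
    (mul_nonneg (sub_nonneg.2 hτ.2) (Real.rpow_nonneg (abs_nonneg R) p))
  have ha1 := Real.rpow_pos_of_pos (div_pos hx2 hD1) (1 / p)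
  have ha2 := Real.rpow_pos_of_pos (div_pos hx3 hD2) (1 / q)
  have hE1 := Real.rpow_pos_of_pos hD1 (1 / p)
  have hE2 := Real.rpow_pos_of_pos hD2 (1 / q)
  have hX2 := Real.rpow_pos_of_pos hx2 (1 / p)
  have hX3 := Real.rpow_pos_of_pos hx3 (1 / q)
  refine ⟨_, _, R, ha1, ha2, hR, τ, 1 - τ, hτ.1.le, sub_nonneg.2 hτ.2, by ring, ?_⟩
  have f0 : τ * (x 2 / (τ + (1 - τ) * rho p R ^ p)) ^ (1 / p)
      + (1 - τ) * (-rho p R * (x 2 / (τ + (1 - τ) * rho p R ^ p)) ^ (1 / p)) = x 0 := by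
    rw [firstRatio, div_eq_div_iff hE1.ne' hX2.ne'] at e1
    rw [Real.div_rpow hx2.le hD1.le]
    field_simp
    linarith
  have f1 : τ * (x 3 / (τ + (1 - τ) * |R| ^ p)) ^ (1 / q)
      + (1 - τ) * (-phi p R * (x 3 / (τ + (1 - τ) * |R| ^ p)) ^ (1 / q)) = x 1 := by
    rw [div_eq_div_iff hE2.ne' hX3.ne'] at e2
    rw [Real.div_rpow hx3.le hD2.le]
    field_simp
    linarith
  have g1 : |(x 2 / (τ + (1 - τ) * rho p R ^ p)) ^ (1 / p)| ^ p
      = x 2 / (τ + (1 - τ) * rho p R ^ p) := by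
    rw [abs_of_pos ha1, ← Real.rpow_mul (div_pos hx2 hD1).le, one_div_mul_cancel hpq.ne_zero,
      Real.rpow_one]
  have g2 : |(x 3 / (τ + (1 - τ) * |R| ^ p)) ^ (1 / q)| ^ q
      = x 3 / (τ + (1 - τ) * |R| ^ p) := by
    rw [abs_of_pos ha2, ← Real.rpow_mul (div_pos hx3 hD2).le,
      one_div_mul_cancel hpq.symm.ne_zero, Real.rpow_one]
  ext i
  fin_cases i
  · simpa [endpointA, endpointB] using f0
  · simpa [endpointA, endpointB] using f1
  · change τ * |_| ^ p + (1 - τ) * |_ * _| ^ p = x 2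
    rw [abs_mul, Real.mul_rpow (abs_nonneg _) (abs_nonneg _), g1, abs_of_pos hρ0]
    field_simp
  · change τ * |_| ^ q + (1 - τ) * (_ * |_| ^ q) = x 3
    rw [g2]
    field_simp

theorem neg_mem_ellC {p q a₁ a₂ R : ℝ} {x : Fin 4 → ℝ}
    (h : ![-x 0, -x 1, x 2, x 3] ∈ ellC p q a₁ a₂ R) : x ∈ ellC p q (-a₁) (-a₂) R := by
  obtain ⟨τ, σ, hτ, hσ, hs, h⟩ := h
  refine ⟨τ, σ, hτ, hσ, hs, ?_⟩
  have h0 := congrFun h 0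
  have h1 := congrFun h 1
  have h2 := congrFun h 2
  have h3 := congrFun h 3
  simp only [endpointA, endpointB, Pi.add_apply, Pi.smul_apply, smul_eq_mul,
    Matrix.cons_val] at h0 h1 h2 h3
  ext i
  fin_cases i
  · change τ * -a₁ + σ * (-rho p R * -a₁) = x 0
    linarith
  · change τ * -a₂ + σ * (-phi p R * -a₂) = x 1
    linarith
  · change τ * |-a₁| ^ p + σ * |rho p R * -a₁| ^ p = x 2
    rw [mul_neg, abs_neg, abs_neg]; exact h2
  · change τ * |-a₂| ^ q + σ * (|R| ^ p * |-a₂| ^ q) = x 3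
    rw [abs_neg]; exact h3

end SharpHoelder

/-! ### Assembly of the four statements -/

theorem mainTheorem4 (p q : ℝ) (hp : 2 < p) (hpq : 1 / p + 1 / q = 1)
    (α β : ℝ) (hαβ : α < β) :
    -- the Bellman function is linear on each segment, with the given values
    (∀ R ∈ Set.Icc (-1 : ℝ) 1, ∀ a₁ a₂ : ℝ, 0 < a₁ * a₂ → ∀ τ ∈ Set.Icc (0 : ℝ) 1,
      SharpHoelder.bellmanC p q α β
          (τ • SharpHoelder.endpointA p q a₁ a₂ + (1 - τ) • SharpHoelder.endpointB p q a₁ a₂ R)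
        = (τ : EReal) * SharpHoelder.bellmanC p q α β (SharpHoelder.endpointA p q a₁ a₂)
          + ((1 - τ : ℝ) : EReal)
            * SharpHoelder.bellmanC p q α β (SharpHoelder.endpointB p q a₁ a₂ R) ∧
      SharpHoelder.bellmanC p q α β
          (τ • SharpHoelder.endpointA p q a₁ a₂ + (1 - τ) • SharpHoelder.endpointB p q a₁ a₂ R)
        = ((a₁ * a₂ * (τ + (1 - τ) * (SharpHoelder.rho p R * SharpHoelder.phi p R)) : ℝ)
            : EReal)) ∧
    -- the segments on which it equals `x₃^(1/p) x₄^(1/q)`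
    (∀ R ∈ Set.Icc (SharpHoelder.R0 p) 1, ∀ a₁ a₂ : ℝ, 0 < a₁ * a₂ →
      ∀ x ∈ SharpHoelder.ellC p q a₁ a₂ R,
        SharpHoelder.bellmanC p q α β x = ((x 2 ^ (1 / p) * x 3 ^ (1 / q) : ℝ) : EReal)) ∧
    -- the segments with `a₁, a₂ > 0` cover one half of the domain
    (∀ x ∈ SharpHoelder.omegaC p q, 0 < x 2 → 0 < x 3 →
      -1 < x 0 / x 2 ^ (1 / p) → x 0 / x 2 ^ (1 / p) ≤ x 1 / x 3 ^ (1 / q) →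
      x 1 / x 3 ^ (1 / q) < 1 →
      ∃ a₁ a₂ R : ℝ, 0 < a₁ ∧ 0 < a₂ ∧ R ∈ Set.Icc (-1 : ℝ) 1 ∧
        x ∈ SharpHoelder.ellC p q a₁ a₂ R) ∧
    -- the segments with `a₁, a₂ < 0` cover the other half
    (∀ x ∈ SharpHoelder.omegaC p q, 0 < x 2 → 0 < x 3 →
      -1 < x 1 / x 3 ^ (1 / q) → x 1 / x 3 ^ (1 / q) ≤ x 0 / x 2 ^ (1 / p) →
      x 0 / x 2 ^ (1 / p) < 1 →
      ∃ a₁ a₂ R : ℝ, a₁ < 0 ∧ a₂ < 0 ∧ R ∈ Set.Icc (-1 : ℝ) 1 ∧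
        x ∈ SharpHoelder.ellC p q a₁ a₂ R) := by
  have hc : p.HolderConjugate q :=
    Real.holderConjugate_iff.2 ⟨by linarith, by rw [← one_div, ← one_div]; exact hpq⟩
  refine ⟨fun R hR a₁ a₂ ha τ hτ => ?_, fun R hR a₁ a₂ ha x hx =>
    SharpHoelder.bellmanC_of_mem_ellC hp hc hαβ hR ha hx, fun x _ hx2 hx3 h1 h12 h2 =>
    SharpHoelder.exists_mem_ellC hp hc hx2 hx3 h1 h12 h2, fun x _ hx2 hx3 h1 h12 h2 => ?_⟩
  · have h := SharpHoelder.bellmanC_segment hp hc hαβ hR ha hτ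
    -- The endpoint values are the cases `τ = 1` and `τ = 0` of the value formula, which is affine
    -- in `τ`.
    have hA := SharpHoelder.bellmanC_segment hp hc hαβ hR ha (right_mem_Icc.2 zero_le_one)
    have hB := SharpHoelder.bellmanC_segment hp hc hαβ hR ha (left_mem_Icc.2 zero_le_one)
    simp only [one_smul, sub_self, zero_smul, add_zero, zero_mul, mul_one] at hA
    simp only [one_smul, sub_zero, zero_smul, zero_add, one_mul] at hB
    refine ⟨?_, h⟩
    rw [h, hA, hB, ← EReal.coe_mul, ← EReal.coe_mul, ← EReal.coe_add]
    congr 1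
    ring
  -- Changing the signs of `f` and `g` together negates `x₁` and `x₂` and exchanges the two halves
  -- of the domain.
  · obtain ⟨a₁, a₂, R, ha₁, ha₂, hR, hx⟩ :=
      SharpHoelder.exists_mem_ellC (x := ![-x 0, -x 1, x 2, x 3]) hp hc hx2 hx3
        (by change -1 < -x 0 / x 2 ^ (1 / p); rw [neg_div]; linarith)
        (by
          change -x 0 / x 2 ^ (1 / p) ≤ -x 1 / x 3 ^ (1 / q)
          rw [neg_div, neg_div]; linarith)
        (by change -x 1 / x 3 ^ (1 / q) < 1; rw [neg_div]; linarith)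
    exact ⟨-a₁, -a₂, R, neg_neg_of_pos ha₁, neg_neg_of_pos ha₂, hR,
      SharpHoelder.neg_mem_ellC hx⟩
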